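/- Setting. There are $K$ items, feature vectors $\phi_{i,j}\in\mathbb R^d$ ($d\ge 1$) with $\|\phi_{i,j}\|\le 1$ and $\phi_{i,j}=-\phi_{j,i}$, an unknown $\theta^*\in\mathbb R^d$, and a monotonically increasing link function $\mu:\mathbb R\to\mathbb R$ with $\mu(x)+\mu(-x)=1$ such that $p_{i,j}=\mu(\phi_{i,j}^\top\theta^*)\in[0,1]$ for all $i,j$. In round $t$ a pair $(i_t,j_t)$ is queried and feedback $r_t\in\{0,1\}$ is received, which given the past and $(i_t,j_t)$ is Bernoulli with mean $p_{i_t,j_t}$. Let $B(i)=\frac1K\sum_{j=1}^K p_{i,j}$, let $i^*$ maximize $B$, and let $$\mathrm{Regret}(T)=\sum_{t=1}^T\bigl(2B(i^*)-B(i_t)-B(j_t)\bigr).$$ Assume that $\lambda_{\min}\bigl(\frac1{K^2}\sum_{i,j}\phi_{i,j}\phi_{i,j}^\top\bigr)\ge\lambda_0>0$, that $\kappa:=\inf_{\|x\|\le1,\ \|\theta-\theta^*\|\le1}\dot\mu(x^\top\theta)>0$, and that $\mu$ is twice differentiable with $|\dot\mu|\le L_\mu$ and $|\ddot\mu|\le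 M_\mu$. Algorithm BETC-GLM with parameters $\tau\in\mathbb N$ and $\epsilon>0$, run for $T$ rounds. (1) In the first $\tau$ rounds $(i_t,j_t)$ is drawn independently and uniformly from $[K]^2$. (2) Let $\pi$ be a G-optimal design, i.e. a probability distribution on $[K]^2$ minimizing $g(\pi)=\max_{i,j}\phi_{i,j}^\top V(\pi)^{-1}\phi_{i,j}$, $V(\pi)=\sum_{i,j}\pi(i,j)\phi_{i,j}\phi_{i,j}^\top$, over the distributions with $V(\pi)$ invertible, and chosen with at most $d(d+1)/2$ support points. Each pair $(i,j)$ is queried $N(i,j)=\lceil d\,\pi(i,j)/\epsilon^2\rceil$ times; let $N=\sum_{i,j}N(i,j)$. (3) Let $\hat\theta$ be the maximum likelihood estimator, i.e. a solution of $\sum_{t\le\tau+N}\mu(\phi_{i_t,j_t}^\top\hat\theta)\phi_{i_t,j_t}=\sum_{t\le\tau+N}r_t\phi_{i_t,j_t}$ (an arbitrary vector if there is no solution), and let $\hat i$ maximize $\hat B(i)=\frac1K\sum_j\mu(\phi_{i,j}^\top\hat\theta)$. In all remaining rounds $(\hat i,\hat i)$ is queried. (If $\tau+N\ge T$, the algorithm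 just stops after $T$ rounds.) Theorem (regret bound for fewer arms). There are constants $C_3,C>0$, depending only on $L_\mu$ and $M_\mu$, such that the following holds. Let $\delta>0$, suppose $$T\ \ge\ \frac{C_3}{\kappa^6\lambda_0^{3/2}}\max\Bigl\{d^{5/2},\ \frac{\log(K^2/\delta)}{\sqrt d}\Bigr\},$$ and run BETC-GLM with $\tau=\bigl\lceil(d\log(K/\delta))^{1/3}T^{2/3}\bigr\rceil$ and $\epsilon=d^{1/3}T^{-1/3}\log(3K^2/\delta)^{-1/6}$. Then with probability at least $1-2\delta$, $$\mathrm{Regret}(T)\ \le\ C\,\kappa^{-1}\,(d\log(K/\delta))^{1/3}\,T^{2/3}.$$ In particular, if the condition on $T$ holds for $\delta=1/T$ and the algorithm is run with $\delta=1/T$, then $$\mathbb E[\mathrm{Regret}(T)]\le C\kappa^{-1}(d\log(KT))^{1/3}T^{2/3}\quad\text{and}\quad \mathbb E[\mathrm{Regret}(T)]\le C\kappa^{-1}(d\log K)^{1/3}T^{2/3}(1+\log T)^{1/3},$$ that is, the expected regret is $\tilde O\bigl(\kappa^{-1}(d\log K)^{1/3}T^{2/3}\bigr)$. -/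

import Mathlib

open scoped RealInnerProductSpace

noncomputable section

namespace BordaDueling

/-- A stochastic generalized linear dueling bandit with `K` items and feature dimension `d`:
feature vectors `φ i j`, hidden parameter `θstar`, link function `μ`; item `i` beats item `j`
with probability `μ ⟪φ i j, θstar⟫`. -/
structure GLMBandit (K d : ℕ) where
  φ : Fin K → Fin K → EuclideanSpace ℝ (Fin d)
  θstar : EuclideanSpace ℝ (Fin d)
  μ : ℝ → ℝ
  norm_φ_le : ∀ i j, ‖φ i j‖ ≤ 1
  φ_skew : ∀ i j, φ i j = -φ j i
  μ_mono : Monotone μ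
  μ_symm : ∀ x, μ x + μ (-x) = 1
  prob_nonneg : ∀ i j, 0 ≤ μ ⟪φ i j, θstar⟫
  prob_le_one : ∀ i j, μ ⟪φ i j, θstar⟫ ≤ 1

/-- One round: the queried pair `(i, j)` and the feedback, `true` meaning that `i` is preferred
to `j`. -/
abbrev Round (K : ℕ) : Type := (Fin K × Fin K) × Bool

/-- The record of the first `n` rounds. -/
abbrev History (K n : ℕ) : Type := Fin n → Round K

/-- A (randomized) algorithm: given the record of the first `n` rounds, the distribution of the
pair that is queried in the next one. -/
abbrev Policy (K : ℕ) : Type := (n : ℕ) → History K n → PMF (Fin K × Fin K)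

/-- The Bernoulli distribution on `Bool` with `P(true) = p`. -/
def bernoulliPMF (p : ℝ) (h0 : 0 ≤ p) (h1 : p ≤ 1) : PMF Bool :=
  PMF.ofFintype (fun b => ENNReal.ofReal (if b then p else 1 - p)) (by
    rw [Fintype.sum_bool, ← ENNReal.ofReal_add (by simpa using h0) (by simpa using h1)]
    simp)

namespace GLMBandit

variable {K d : ℕ} (B : GLMBandit K d)

/-- The preference probability `p_{i,j}`. -/
def prob (i j : Fin K) : ℝ := B.μ ⟪B.φ i j, B.θstar⟫

/-- The distribution of the feedback when the pair `a` is queried. -/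
def feedback (a : Fin K × Fin K) : PMF Bool :=
  bernoulliPMF (B.prob a.1 a.2) (B.prob_nonneg a.1 a.2) (B.prob_le_one a.1 a.2)

/-- The law of the first `n` rounds when the algorithm `A` interacts with the bandit. -/
def law (A : Policy K) : (n : ℕ) → PMF (History K n)
  | 0 => PMF.pure Fin.elim0
  | n + 1 =>
    (law A n).bind fun h =>
      (A n h).bind fun a =>
        (B.feedback a).bind fun r =>
          PMF.pure (Fin.snoc (α := fun _ => Round K) h (a, r))

/-- The Borda score `B(i) = (1/K) ∑ⱼ p_{i,j}`. -/
def borda (i : Fin K) : ℝ := (1 / (K : ℝ)) * ∑ j, B.prob i j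

/-- The Borda regret `∑ₜ (2 B(i*) - B(iₜ) - B(jₜ))` of a record, `i*` being a Borda winner. -/
def regret {n : ℕ} (h : History K n) : ℝ :=
  ∑ t, (2 * (⨆ i, B.borda i) - B.borda (h t).1.1 - B.borda (h t).1.2)

/-- The matrix `(1/K²) ∑ᵢ ∑ⱼ φ_{i,j} φ_{i,j}ᵀ`. -/
def uniformMatrix : Matrix (Fin d) (Fin d) ℝ :=
  (1 / (K : ℝ) ^ 2) • ∑ i, ∑ j, Matrix.vecMulVec (B.φ i j).ofLp (B.φ i j).ofLp

/-- `lam0` is a lower bound of the smallest eigenvalue of `(1/K²) ∑ᵢ ∑ⱼ φ_{i,j} φ_{i,j}ᵀ`. -/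
def MinEigenvalueGE (lam0 : ℝ) : Prop :=
  ∀ a ∈ spectrum ℝ B.uniformMatrix, lam0 ≤ a

/-- `κ = inf {μ'(xᵀθ) : ‖x‖ ≤ 1, ‖θ - θstar‖ ≤ 1}`. -/
def kappa : ℝ :=
  sInf ((fun q : EuclideanSpace ℝ (Fin d) × EuclideanSpace ℝ (Fin d) => deriv B.μ ⟪q.1, q.2⟫) ''
    {q | ‖q.1‖ ≤ 1 ∧ ‖q.2 - B.θstar‖ ≤ 1})

/-- The link function is twice differentiable and its first and second derivatives are bounded by
`L` and `M`. -/
def SmoothLink (L M : ℝ) : Prop :=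
  Differentiable ℝ B.μ ∧ Differentiable ℝ (deriv B.μ) ∧
    (∀ x, |deriv B.μ x| ≤ L) ∧ ∀ x, |deriv (deriv B.μ) x| ≤ M

/-! ### G-optimal designs -/

/-- `V(π) = ∑_{i,j} π(i,j) φ_{i,j} φ_{i,j}ᵀ`. -/
def designMatrix (π : Fin K × Fin K → ℝ) : Matrix (Fin d) (Fin d) ℝ :=
  ∑ a, π a • Matrix.vecMulVec (B.φ a.1 a.2).ofLp (B.φ a.1 a.2).ofLp

/-- `g(π) = max_{i,j} φ_{i,j}ᵀ V(π)⁻¹ φ_{i,j}`, for `π` with `V(π)` positive definite. -/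
def designValue (π : Fin K × Fin K → ℝ) : ℝ :=
  ⨆ a : Fin K × Fin K,
    (B.φ a.1 a.2).ofLp ⬝ᵥ ((B.designMatrix π)⁻¹.mulVec (B.φ a.1 a.2).ofLp)

/-- `π` is a probability distribution on pairs that minimizes `g`. Distributions with a singular
`V(π)`, for which `g` is infinite, do not compete. -/
def IsGOptimal (π : Fin K × Fin K → ℝ) : Prop :=
  π ∈ stdSimplex ℝ (Fin K × Fin K) ∧ (B.designMatrix π).PosDef ∧
    ∀ π' ∈ stdSimplex ℝ (Fin K × Fin K), (B.designMatrix π').PosDef →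
      B.designValue π ≤ B.designValue π'

/-! ### Maximum likelihood and estimated scores -/

/-- The maximum likelihood equation `∑ₜ μ(φₜᵀθ) φₜ = ∑ₜ rₜ φₜ` for the record `h`. -/
def IsMLE {n : ℕ} (h : History K n) (θ : EuclideanSpace ℝ (Fin d)) : Prop :=
  ∑ t, B.μ ⟪B.φ (h t).1.1 (h t).1.2, θ⟫ • B.φ (h t).1.1 (h t).1.2 =
    ∑ t, (if (h t).2 then (1 : ℝ) else 0) • B.φ (h t).1.1 (h t).1.2

/-- The estimated Borda score `(1/K) ∑ⱼ μ(φ_{i,j}ᵀθ)`. -/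
def estBorda (θ : EuclideanSpace ℝ (Fin d)) (i : Fin K) : ℝ :=
  (1 / (K : ℝ)) * ∑ j, B.μ ⟪B.φ i j, θ⟫

end GLMBandit

/-! ### The algorithm -/

/-- The list of queries of the designed exploration: for `i`, for `j`, the pair `(i, j)` is
repeated `⌈d π(i,j) / ε²⌉` times. -/
def designedQueries {K : ℕ} (d : ℕ) (π : Fin K × Fin K → ℝ) (ε : ℝ) : List (Fin K × Fin K) :=
  (List.finRange K).flatMap fun i =>
    (List.finRange K).flatMap fun j =>
      List.replicate ⌈(d : ℝ) * π (i, j) / ε ^ 2⌉₊ (i, j)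

/-- Explore, then commit: `τ` rounds of independent uniform queries, then the queries in the list
`l`, then the pair `(i, i)` in all later rounds, where `i` is computed from the record of all
exploration rounds by the rule `commit`. -/
def etcPolicy {K : ℕ} [NeZero K] (τ : ℕ) (l : List (Fin K × Fin K))
    (commit : History K (τ + l.length) → Fin K) : Policy K := fun n h =>
  if h1 : n < τ then PMF.uniformOfFintype (Fin K × Fin K)
  else if h2 : n - τ < l.length then PMF.pure l[n - τ]
  else
    let i := commit fun t => h (Fin.castLE (by omega) t)
    PMF.pure (i, i)

/-- `A` is BETC-GLM for the bandit `B` with `τ` uniform exploration rounds and error tolerance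
`ε`: for a G-optimal design `π` with at most `d(d+1)/2` support points, it explores and then
commits to an item maximizing the estimated Borda score of the maximum likelihood estimator. The
design, the estimator `θhat` (arbitrary on records for which the likelihood equation has no
solution) and the tie-breaking are up to the implementation. -/
def IsBETCGLM {K d : ℕ} [NeZero K] (B : GLMBandit K d) (τ : ℕ) (ε : ℝ) (A : Policy K) : Prop :=
  ∃ π : Fin K × Fin K → ℝ,
    B.IsGOptimal π ∧
    (Finset.univ.filter fun a => π a ≠ 0).card ≤ d * (d + 1) / 2 ∧
    ∃ (θhat : History K (τ + (designedQueries d π ε).length) → EuclideanSpace ℝ (Fin d))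
      (ihat : History K (τ + (designedQueries d π ε).length) → Fin K),
      (∀ h, (∃ θ, B.IsMLE h θ) → B.IsMLE h (θhat h)) ∧
      (∀ h i, B.estBorda (θhat h) i ≤ B.estBorda (θhat h) (ihat h)) ∧
      A = etcPolicy τ (designedQueries d π ε) ihat

/-- The number of uniform exploration rounds, `(d log(K/δ))^{1/3} T^{2/3}` rounded up. -/
def tauParam (K d T : ℕ) (δ : ℝ) : ℕ :=
  ⌈((d : ℝ) * Real.log (K / δ)) ^ (1 / 3 : ℝ) * (T : ℝ) ^ (2 / 3 : ℝ)⌉₊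

/-- The error tolerance `d^{1/3} T^{-1/3} log(3K²/δ)^{-1/6}`. -/
def epsParam (K d T : ℕ) (δ : ℝ) : ℝ :=
  (d : ℝ) ^ (1 / 3 : ℝ) * (T : ℝ) ^ (-(1 / 3) : ℝ) *
    Real.log (3 * (K : ℝ) ^ 2 / δ) ^ (-(1 / 6) : ℝ)

end BordaDueling

end

/-! The exploration queries do not depend on the feedback, so given the query sequence the feedback
is independent Bernoulli and Hoeffding's bound applies to each fixed linear combination of the
noise. Write `A v` for the vector of inner products of `v` with the queried features. By
Kiefer–Wolfowitz a G-optimal design has value at most `d`, so the rounded design alone gives `|⟪φ_a,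
v⟫| ≤ ε ‖A v‖` for every pair `a`; the uniform rounds only enlarge `‖A v‖`.

The estimator is analysed deterministically on a good event (`abs_inner_score_zero_le`). A net in
the range of `A` bounds the noise functional by `N ‖A v‖`, with `N` of order `√(d² + l)` and `l =
log(3K²/δ)`. The score then points outwards wherever `‖A v‖ ≥ 4N/κ`, so a solution exists and every
solution lies within that radius of `θ*`. This crude bound is sharpened by testing the likelihood
equation on vectors dual to the `φ_a` for the Gram form weighted by the link's derivative at `θ*`.
The linear part is the prediction error at `a`, the noise part is at most `(ε/κ)√l`, and the
second-order remainder is at most half the largest prediction error once `8MNε ≤ κ²`. Absorbing it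
leaves the error `2(ε/κ)√l` for all pairs, without a dimension factor.

Since the link is `L`-Lipschitz, the committed item has Borda gap at most `4L(ε/κ)√l`. The regret is
at most `2(τ + d/ε² + d²) + 8LT(ε/κ)√l`, and the prescribed parameters balance these terms. The
horizon condition makes the remainder absorbable. The eigenvalue assumption enters through `K ≥ 2`
and `d λ₀ ≤ trace ≤ 1`. -/

noncomputable section

namespace BordaDueling

open Filter Topology

/-! ### Deterministic analysis of the likelihood equation -/

section MaximumLikelihood

variable {E : Type*} [NormedAddCommGroup E] [InnerProductSpace ℝ E]
  {ι : Type*}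

/-- The linear map sending `v` to its inner products with the vectors `φ t`. -/
def queryMap (φ : ι → E) : E →ₗ[ℝ] EuclideanSpace ℝ ι where
  toFun v := WithLp.toLp 2 fun t => ⟪φ t, v⟫
  map_add' u v := by ext t; simp [inner_add_right]
  map_smul' c v := by ext t; simp [inner_smul_right]

@[simp] theorem queryMap_apply (φ : ι → E) (v : E) (t : ι) : queryMap φ v t = ⟪φ t, v⟫ := rfl

theorem norm_queryMap_sq [Fintype ι] (φ : ι → E) (v : E) : ‖queryMap φ v‖ ^ 2 = ∑ t, ⟪φ t, v⟫ ^ 2 := by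
  simp [EuclideanSpace.norm_sq_eq]

variable [Fintype ι]

/-- The secant slope of a function whose derivative is `M`-Lipschitz. -/
theorem exists_secant_slope {μ : ℝ → ℝ} {M : ℝ} (hμ : Differentiable ℝ μ)
    (hM : ∀ x y, |deriv μ x - deriv μ y| ≤ M * |x - y|) (hM0 : 0 ≤ M) (c x : ℝ) :
    ∃ g, μ x - μ c = g * (x - c) ∧ |g - deriv μ c| ≤ M * |x - c| := by
  rcases lt_trichotomy c x with h | h | h
  · obtain ⟨ξ, hξ, h1⟩ := exists_deriv_eq_slope μ h hμ.continuous.continuousOn hμ.differentiableOn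
    refine ⟨deriv μ ξ, ?_, (hM ξ c).trans ?_⟩
    · rw [h1]; field_simp [(sub_pos.2 h).ne']
    · gcongr 1
      rw [abs_of_pos (by linarith [hξ.1]), abs_of_pos (by linarith)]
      linarith [hξ.2]
  · subst h; exact ⟨deriv μ c, by simp, by simp⟩
  · obtain ⟨ξ, hξ, h1⟩ := exists_deriv_eq_slope μ h hμ.continuous.continuousOn hμ.differentiableOn
    refine ⟨deriv μ ξ, ?_, (hM ξ c).trans ?_⟩
    · have : c - x ≠ 0 := (sub_pos.2 h).ne'
      rw [h1]; field_simp; ring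
    · gcongr 1
      rw [abs_of_neg (by linarith [hξ.2]), abs_of_neg (by linarith)]
      linarith [hξ.1]

/-- A likelihood equation whose score points outwards on the sphere `‖queryMap φ v‖ = ρ` has a
solution inside. -/
theorem exists_score_eq_zero [FiniteDimensional ℝ E] {μ : ℝ → ℝ} (hμ : Continuous μ) (φ : ι → E)
    (hφ : Function.Injective (queryMap φ)) (θ : E) (r : ι → ℝ) {ρ : ℝ} (hρ : 0 < ρ)
    (hpos : ∀ v, ‖queryMap φ v‖ = ρ → 0 < ∑ t, (μ ⟪φ t, θ + v⟫ - r t) * ⟪φ t, v⟫) :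
    ∃ v, ∑ t, (μ ⟪φ t, θ + v⟫ - r t) • φ t = 0 := by
  set A := queryMap φ
  have hAc : Continuous A := A.continuous_of_finiteDimensional
  have hK : IsCompact (A ⁻¹' Metric.closedBall 0 ρ) :=
    (LinearMap.isClosedEmbedding_of_injective (LinearMap.ker_eq_bot.2 hφ)).isCompact_preimage
      (isCompact_closedBall _ _)
  -- The score is the gradient of the potential `Ψ` built from a primitive of `μ`. A minimizer of
  -- `Ψ` on the ellipsoid, compact by injectivity of `A`, is shown to be interior.
  let m : ℝ → ℝ := fun x => ∫ y in (0 : ℝ)..x, μ y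
  have hm : ∀ x, HasDerivAt m (μ x) x := fun x => (hμ.integral_hasStrictDerivAt 0 x).hasDerivAt
  have hmc : Continuous m := continuous_iff_continuousAt.2 fun x => (hm x).continuousAt
  let Ψ : E → ℝ := fun v => ∑ t, (m ⟪φ t, θ + v⟫ - r t * ⟪φ t, θ + v⟫)
  have hΨc : Continuous Ψ := by fun_prop
  obtain ⟨v, hvK, hmin⟩ := hK.exists_isMinOn ⟨0, by simp [hρ.le]⟩ hΨc.continuousOn
  -- First-order condition: the derivative is nonnegative in every direction along which small steps
  -- stay in the ellipsoid.
  have key : ∀ u, (∀ᶠ s in 𝓝[>] (0 : ℝ), ‖A (v + s • u)‖ ≤ ρ) →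
      0 ≤ ∑ t, (μ ⟪φ t, θ + v⟫ - r t) * ⟪φ t, u⟫ := by
    intro u hu
    have hder : HasDerivAt (fun s : ℝ => Ψ (v + s • u))
        (∑ t, (μ ⟪φ t, θ + v⟫ - r t) * ⟪φ t, u⟫) 0 := by
      refine HasDerivAt.fun_sum fun t _ => ?_
      have h1 : HasDerivAt (fun s : ℝ => ⟪φ t, θ + (v + s • u)⟫) ⟪φ t, u⟫ 0 := by
        have : (fun s : ℝ => ⟪φ t, θ + (v + s • u)⟫) =
            fun s : ℝ => ⟪φ t, θ + v⟫ + s * ⟪φ t, u⟫ := by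
          funext s; simp only [inner_add_right, inner_smul_right]; ring
        rw [this]
        simpa using ((hasDerivAt_id (0 : ℝ)).mul_const ⟪φ t, u⟫).const_add ⟪φ t, θ + v⟫
      have h2 : HasDerivAt (fun s : ℝ => m ⟪φ t, θ + (v + s • u)⟫)
          (μ ⟪φ t, θ + v⟫ * ⟪φ t, u⟫) 0 := by
        have := (hm ⟪φ t, θ + (v + (0 : ℝ) • u)⟫).comp (0 : ℝ) h1
        simp only [zero_smul, add_zero] at this
        exact this
      rw [sub_mul]
      exact h2.sub (h1.const_mul (r t))
    refine ge_of_tendsto hder.tendsto_slope_zero_right ?_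
    filter_upwards [hu, self_mem_nhdsWithin] with s hs hs0
    have h3 : Ψ v ≤ Ψ (v + s • u) := hmin (by simpa using hs)
    have hs0 : (0 : ℝ) < s := hs0
    simp only [zero_add, zero_smul, add_zero, smul_eq_mul]
    exact mul_nonneg (inv_nonneg.2 hs0.le) (by linarith)
  have hvρ : ‖A v‖ ≤ ρ := by simpa using hvK
  -- At a boundary minimizer the inward direction `-v` would strictly decrease `Ψ`, by `hpos`.
  have hlt : ‖A v‖ < ρ := by
    refine lt_of_le_of_ne hvρ fun heq => ?_
    have h4 := key (-v) ?_
    · have h5 := hpos v heq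
      simp only [inner_neg_right, mul_neg, Finset.sum_neg_distrib] at h4
      linarith
    · filter_upwards [Ioc_mem_nhdsGT (show (0 : ℝ) < 1 by norm_num)] with s hs
      have : v + s • -v = (1 - s) • v := by module
      rw [this, map_smul, norm_smul, Real.norm_of_nonneg (by linarith [hs.2]), heq]
      nlinarith [hs.1]
  have hev : ∀ u, ∀ᶠ s in 𝓝[>] (0 : ℝ), ‖A (v + s • u)‖ ≤ ρ := by
    intro u
    have hc : Continuous fun s : ℝ => ‖A (v + s • u)‖ := by fun_prop
    have : ∀ᶠ s in 𝓝 (0 : ℝ), ‖A (v + s • u)‖ < ρ :=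
      hc.continuousAt.eventually_lt continuousAt_const (by simpa using hlt)
    exact (this.filter_mono nhdsWithin_le_nhds).mono fun s hs => hs.le
  refine ⟨v, ?_⟩
  refine ext_inner_right ℝ fun u => ?_
  have h6 := key u (hev u)
  have h7 := key (-u) (hev (-u))
  simp only [inner_neg_right, mul_neg, Finset.sum_neg_distrib] at h7
  simp only [sum_inner, inner_smul_left, inner_zero_left, RCLike.conj_to_real]
  linarith

/-- Outside the ellipsoid `‖queryMap φ v‖ < ρ` the score points outwards. -/
theorem score_pos {μ : ℝ → ℝ} {M κ ε ρ N : ℝ} (hmono : Monotone μ) (hμ : Differentiable ℝ μ)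
    (hM : ∀ x y, |deriv μ x - deriv μ y| ≤ M * |x - y|) (hM0 : 0 ≤ M)
    (φ : ι → E) (θ : E) (r : ι → ℝ) (hκ : ∀ t, κ ≤ deriv μ ⟪φ t, θ⟫)
    (hφ : ∀ t v, |⟪φ t, v⟫| ≤ ε * ‖queryMap φ v‖) (hρ : 0 < ρ) (hMρ : M * (ε * ρ) ≤ κ / 2)
    (hN : N < κ / 2 * ρ)
    (hy : ∀ v, ∑ t, (r t - μ ⟪φ t, θ⟫) * ⟪φ t, v⟫ ≤ N * ‖queryMap φ v‖)
    (v : E) (hv : ρ ≤ ‖queryMap φ v‖) :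
    0 < ∑ t, (μ ⟪φ t, θ + v⟫ - r t) * ⟪φ t, v⟫ := by
  set R := ‖queryMap φ v‖ with hR
  have hR0 : 0 < R := hρ.trans_le hv
  -- The point `c • v` is on the ellipsoid of radius `ρ`, where increments are so small that secant
  -- slopes stay above `κ / 2`. Monotonicity of `μ` carries the lower bound from `c • v` out to `v`.
  set c := ρ / R with hc
  have hc0 : 0 < c := div_pos hρ hR0
  have hc1 : c ≤ 1 := (div_le_one hR0).2 hv
  have hterm : ∀ t, κ / 2 * (c * ⟪φ t, v⟫ ^ 2) ≤
      (μ ⟪φ t, θ + v⟫ - μ ⟪φ t, θ⟫) * ⟪φ t, v⟫ := by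
    intro t
    set z := ⟪φ t, v⟫ with hz
    set b := ⟪φ t, θ⟫ with hb
    have h1 : ⟪φ t, θ + v⟫ = b + z := inner_add_right _ _ _
    obtain ⟨g, hg, hgM⟩ := exists_secant_slope hμ hM hM0 b (b + c * z)
    simp only [add_sub_cancel_left] at hg hgM
    have hcz : |c * z| ≤ ε * ρ := by
      rw [abs_mul, abs_of_pos hc0]
      calc c * |z| ≤ c * (ε * R) := by gcongr; exact hφ t v
        _ = ε * ρ := by rw [hc]; field_simp
    have hgκ : κ / 2 ≤ g := by
      have := (hgM.trans (mul_le_mul_of_nonneg_left hcz hM0)).trans hMρ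
      have := (abs_le.1 this).1
      linarith [hκ t]
    have h2 : (μ (b + c * z) - μ b) * z ≤ (μ (b + z) - μ b) * z := by
      rcases le_total 0 z with h | h
      · exact mul_le_mul_of_nonneg_right
          (sub_le_sub_right (hmono (by nlinarith)) _) h
      · exact mul_le_mul_of_nonpos_right
          (sub_le_sub_right (hmono (by nlinarith)) _) h
    rw [h1]
    refine le_trans ?_ h2
    rw [hg]
    have : 0 ≤ c * z ^ 2 := by positivity
    nlinarith
  have hsum := Finset.sum_le_sum fun t (_ : t ∈ Finset.univ) => hterm t
  rw [← Finset.mul_sum, ← Finset.mul_sum, ← norm_queryMap_sq, ← hR] at hsum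
  have h3 : c * R ^ 2 = ρ * R := by rw [hc]; field_simp
  rw [h3] at hsum
  have h4 := hy v
  have h5 : ∑ t, (μ ⟪φ t, θ + v⟫ - r t) * ⟪φ t, v⟫ =
      ∑ t, (μ ⟪φ t, θ + v⟫ - μ ⟪φ t, θ⟫) * ⟪φ t, v⟫ -
        ∑ t, (r t - μ ⟪φ t, θ⟫) * ⟪φ t, v⟫ := by
    rw [← Finset.sum_sub_distrib]; congr 1; funext t; ring
  rw [h5]
  nlinarith

/-- A dual vector of a direction has a small image under `queryMap`. -/
theorem norm_queryMap_dual_le (φ : ι → E) (c : ι → ℝ) {κ ε : ℝ} (hκ0 : 0 < κ) (hε : 0 ≤ ε)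
    (hc : ∀ t, κ ≤ c t) {x w : E} (hx : ∀ v, |⟪x, v⟫| ≤ ε * ‖queryMap φ v‖)
    (hw : ∀ v, ∑ t, c t * (⟪φ t, w⟫ * ⟪φ t, v⟫) = ⟪x, v⟫) : ‖queryMap φ w‖ ≤ ε / κ := by
  have h1 : κ * ‖queryMap φ w‖ ^ 2 ≤ ε * ‖queryMap φ w‖ := by
    calc κ * ‖queryMap φ w‖ ^ 2 = ∑ t, κ * ⟪φ t, w⟫ ^ 2 := by
          rw [norm_queryMap_sq, Finset.mul_sum]
      _ ≤ ∑ t, c t * (⟪φ t, w⟫ * ⟪φ t, w⟫) := by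
          refine Finset.sum_le_sum fun t _ => ?_
          rw [← sq]
          exact mul_le_mul_of_nonneg_right (hc t) (sq_nonneg _)
      _ = ⟪x, w⟫ := hw _
      _ ≤ _ := (le_abs_self _).trans (hx _)
  rw [le_div_iff₀ hκ0]
  rcases (norm_nonneg (queryMap φ w)).eq_or_lt with h | h
  · rw [← h]; simpa using hε
  · exact le_of_mul_le_mul_right (by nlinarith) h

/-- Solutions of the likelihood equation are accurate in every direction `x a`, provided the noise
is small on the dual vectors `w a` of these directions and on the whole range of `queryMap φ`. -/
theorem abs_inner_score_zero_le [FiniteDimensional ℝ E] {μ : ℝ → ℝ} {M κ ε N b : ℝ} (hmono : Monotone μ)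
    (hμ : Differentiable ℝ μ)
    (hM : ∀ x y, |deriv μ x - deriv μ y| ≤ M * |x - y|) (hM0 : 0 ≤ M) (hε : 0 ≤ ε) (hκ0 : 0 < κ)
    (hN0 : 0 < N) {α : Type*} [Finite α] [Nonempty α] (x : α → E) (q : ι → α) (θ : E)
    (r : ι → ℝ) (hκ : ∀ t, κ ≤ deriv μ ⟪x (q t), θ⟫)
    (hx : ∀ a v, |⟪x a, v⟫| ≤ ε * ‖queryMap (fun t => x (q t)) v‖)
    (hinj : Function.Injective (queryMap fun t => x (q t)))
    (hMN : 8 * M * N * ε ≤ κ ^ 2)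
    (hy : ∀ v, ∑ t, (r t - μ ⟪x (q t), θ⟫) * ⟪x (q t), v⟫ ≤
      N * ‖queryMap (fun t => x (q t)) v‖)
    (w : α → E)
    (hw : ∀ a v, ∑ t, deriv μ ⟪x (q t), θ⟫ * (⟪x (q t), w a⟫ * ⟪x (q t), v⟫) = ⟪x a, v⟫)
    (hyw : ∀ a, |∑ t, (r t - μ ⟪x (q t), θ⟫) * ⟪x (q t), w a⟫| ≤ b) :
    (∃ θ', ∑ t, μ ⟪x (q t), θ'⟫ • x (q t) = ∑ t, r t • x (q t)) ∧
    ∀ θ', ∑ t, μ ⟪x (q t), θ'⟫ • x (q t) = ∑ t, r t • x (q t) →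
      ∀ a, |⟪x a, θ' - θ⟫| ≤ 2 * b := by
  set φ : ι → E := fun t => x (q t) with hφdef
  -- This radius gives `κ ρ / 2 = 2 N > N`, while `M ε ρ ≤ κ / 2` is exactly `hMN`.
  set ρ := 4 * N / κ with hρdef
  have hρ : 0 < ρ := by positivity
  have hMρ : M * (ε * ρ) ≤ κ / 2 := by
    rw [hρdef, show M * (ε * (4 * N / κ)) = 8 * M * N * ε / (2 * κ) by field_simp; ring,
      div_le_iff₀ (by positivity)]
    nlinarith
  have hNρ : N < κ / 2 * ρ := by
    have : κ / 2 * ρ = 2 * N := by rw [hρdef]; field_simp; norm_num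
    linarith
  have hpos := score_pos hmono hμ hM hM0 φ θ r hκ (fun t v => hx (q t) v) hρ hMρ hNρ hy
  constructor
  · obtain ⟨v, hv⟩ := exists_score_eq_zero hμ.continuous φ hinj θ r hρ
      (fun v hv => hpos v hv.ge)
    refine ⟨θ + v, ?_⟩
    simp only [sub_smul, Finset.sum_sub_distrib] at hv
    exact sub_eq_zero.1 hv
  intro θ' hθ'
  set v := θ' - θ with hv
  have hθv : θ' = θ + v := by simp [hv]
  have hzero : ∀ u, ∑ t, (μ ⟪φ t, θ'⟫ - r t) * ⟪φ t, u⟫ = 0 := by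
    intro u
    have : ⟪∑ t, (μ ⟪φ t, θ'⟫ - r t) • φ t, u⟫ = 0 := by
      simp only [sub_smul, Finset.sum_sub_distrib]
      rw [hθ', sub_self, inner_zero_left]
    simpa [sum_inner, inner_smul_left] using this
  have hvρ : ‖queryMap φ v‖ ≤ ρ := by
    by_contra! hlt
    have := hpos v hlt.le
    rw [← hθv, hzero v] at this
    exact lt_irrefl _ this
  obtain ⟨a₀, ha₀⟩ := Finite.exists_max fun a => |⟪x a, v⟫|
  set m := |⟪x a₀, v⟫| with hm
  have hm0 : 0 ≤ m := abs_nonneg _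
  have hwn := norm_queryMap_dual_le φ (fun t => deriv μ ⟪φ t, θ⟫) hκ0 hε hκ (hx a₀) (hw a₀)
  choose g hg hgM using fun t => exists_secant_slope hμ hM hM0 ⟪φ t, θ⟫ ⟪φ t, θ'⟫
  have hz : ∀ t, ⟪φ t, θ'⟫ - ⟪φ t, θ⟫ = ⟪φ t, v⟫ := fun t => (inner_sub_right _ _ _).symm
  simp only [hz] at hg hgM
  -- The likelihood equation tested on `w a₀`: by duality the linearized part is `⟪x a₀, v⟫`, which
  -- leaves the noise and a second-order remainder.
  have hdecomp : ⟪x a₀, v⟫ = ∑ t, (r t - μ ⟪φ t, θ⟫) * ⟪φ t, w a₀⟫ -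
      ∑ t, (g t - deriv μ ⟪φ t, θ⟫) * ⟪φ t, v⟫ * ⟪φ t, w a₀⟫ := by
    rw [← hw a₀ v]
    have h2 := hzero (w a₀)
    rw [← sub_eq_zero, ← Finset.sum_sub_distrib, ← Finset.sum_sub_distrib, ← h2]
    refine Finset.sum_congr rfl fun t _ => ?_
    have := hg t
    linear_combination (-⟪φ t, w a₀⟫) * this
  -- The queried features are among the `x a`, so the slope error is at most `M * m`. Cauchy–Schwarz
  -- handles the other two factors, and `hMN` lets `m` absorb the result.
  have hrem : |∑ t, (g t - deriv μ ⟪φ t, θ⟫) * ⟪φ t, v⟫ * ⟪φ t, w a₀⟫| ≤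
      M * m * (ρ * (ε / κ)) := by
    calc |∑ t, (g t - deriv μ ⟪φ t, θ⟫) * ⟪φ t, v⟫ * ⟪φ t, w a₀⟫|
        ≤ ∑ t, |(g t - deriv μ ⟪φ t, θ⟫) * ⟪φ t, v⟫ * ⟪φ t, w a₀⟫| :=
          Finset.abs_sum_le_sum_abs _ _
      _ ≤ ∑ t, M * m * (|⟪φ t, v⟫| * |⟪φ t, w a₀⟫|) := by
          refine Finset.sum_le_sum fun t _ => ?_
          rw [abs_mul, abs_mul, mul_assoc]
          gcongr
          exact (hgM t).trans (mul_le_mul_of_nonneg_left (ha₀ (q t)) hM0)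
      _ ≤ M * m * (‖queryMap φ v‖ * ‖queryMap φ (w a₀)‖) := by
          rw [← Finset.mul_sum]
          refine mul_le_mul_of_nonneg_left ?_ (mul_nonneg hM0 hm0)
          have h3 := Real.sum_mul_le_sqrt_mul_sqrt Finset.univ (fun t => |⟪φ t, v⟫|)
            (fun t => |⟪φ t, w a₀⟫|)
          simp only [sq_abs, ← norm_queryMap_sq, Real.sqrt_sq (norm_nonneg _)] at h3
          exact h3
      _ ≤ M * m * (ρ * (ε / κ)) := by gcongr
  have hsmall : M * m * (ρ * (ε / κ)) ≤ m / 2 := by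
    have : M * m * (ρ * (ε / κ)) = m * (8 * M * N * ε) / (2 * κ ^ 2) := by
      rw [hρdef]; field_simp; ring
    rw [this, div_le_div_iff₀ (by positivity) (by norm_num)]
    nlinarith [mul_le_mul_of_nonneg_left hMN hm0]
  have hmle : m ≤ b + m / 2 := by
    calc m = |_ - _| := by rw [hm, hdecomp]
      _ ≤ _ := (abs_sub _ _).trans (add_le_add (hyw a₀) (hrem.trans hsmall))
  intro a
  exact (ha₀ a).trans (by linarith)

/-- The weighted Gram operator of a spanning family is onto. -/
theorem exists_dual_vector [FiniteDimensional ℝ E] (φ : ι → E) (hinj : Function.Injective (queryMap φ)) (c : ι → ℝ)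
    (hc : ∀ t, 0 < c t) (x : E) :
    ∃ w, ∀ v, ∑ t, c t * (⟪φ t, w⟫ * ⟪φ t, v⟫) = ⟪x, v⟫ := by
  let H : E →ₗ[ℝ] E := ∑ t, (c t) • ((innerₛₗ ℝ (φ t)).smulRight (φ t))
  have hH : ∀ u v, ⟪H u, v⟫ = ∑ t, c t * (⟪φ t, u⟫ * ⟪φ t, v⟫) := by
    intro u v
    simp [H, sum_inner, inner_smul_left, LinearMap.sum_apply]
  -- A kernel vector has zero weighted sum of squares, hence zero inner product with every `φ t`.
  have hHinj : Function.Injective H := by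
    refine (injective_iff_map_eq_zero H).2 fun u hu => ?_
    have h1 := hH u u
    rw [hu, inner_zero_left] at h1
    have h2 := (Finset.sum_eq_zero_iff_of_nonneg
      (fun t _ => mul_nonneg (hc t).le (mul_self_nonneg _))).1 h1.symm
    refine (injective_iff_map_eq_zero _).1 hinj u ?_
    ext t
    simpa [(hc t).ne'] using h2 t (Finset.mem_univ t)
  obtain ⟨w, rfl⟩ := LinearMap.surjective_of_injective hHinj x
  exact ⟨w, fun v => (hH w v).symm⟩

end MaximumLikelihood

/-! ### Optimal designs and the eigenvalue condition -/

section OptimalDesign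

open Matrix

/-- A special case of the matrix determinant lemma. -/
theorem det_add_smul_vecMulVec {d : ℕ} {V : Matrix (Fin d) (Fin d) ℝ} (hV : V.PosDef)
    (t : ℝ) (u : Fin d → ℝ) :
    (V + t • vecMulVec u u).det = V.det * (1 + t * (u ⬝ᵥ V⁻¹ *ᵥ u)) := by
  have h := det_add_replicateCol_mul_replicateRow (ι := Unit) (A := V)
    (isUnit_iff_ne_zero.2 hV.det_pos.ne') (t • u) u
  rw [← vecMulVec_eq Unit, smul_vecMulVec] at h
  rw [h]
  congr 1
  rw [Matrix.mul_assoc, ← replicateCol_mulVec, det_unique, Matrix.add_apply, Matrix.one_apply_eq,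
    replicateRow_mul_replicateCol_apply, mulVec_smul, dotProduct_smul, smul_eq_mul]

/-- Comparison of `1 + t g` with `(1 + t)ᵈ` for small `t` gives `g ≤ d`. -/
theorem le_of_one_add_mul_le_pow {g : ℝ} {d : ℕ} (h : ∀ t : ℝ, 0 < t → 1 + t * g ≤ (1 + t) ^ d) :
    g ≤ d := by
  -- This function equals `1` at `0` and is at least `1` on the right, so its derivative there is
  -- nonnegative.
  have hder : HasDerivAt (fun t : ℝ => (1 + t) ^ d - t * g) (d - g) 0 := by
    have h1 := ((hasDerivAt_id (0 : ℝ)).const_add 1).pow d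
    have h2 := (hasDerivAt_id (0 : ℝ)).mul_const g
    have h3 : HasDerivAt (fun t : ℝ => (1 + t) ^ d - t * g)
        (d * (1 + (0 : ℝ)) ^ (d - 1) * 1 - 1 * g) 0 := h1.sub h2
    simpa only [add_zero, one_pow, mul_one, one_mul] using h3
  have : 0 ≤ (d : ℝ) - g := by
    refine ge_of_tendsto hder.tendsto_slope_zero_right ?_
    filter_upwards [self_mem_nhdsWithin] with t ht
    have ht : (0 : ℝ) < t := ht
    have := h t ht
    simp only [zero_add, add_zero, one_pow, zero_mul, sub_zero, smul_eq_mul]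
    exact mul_nonneg (inv_nonneg.2 ht.le) (by linarith)
  linarith

namespace GLMBandit

variable {K d : ℕ} (B : GLMBandit K d)

theorem inner_eq_dotProduct (x y : EuclideanSpace ℝ (Fin d)) : ⟪x, y⟫ = x.ofLp ⬝ᵥ y.ofLp := by
  rw [EuclideanSpace.inner_eq_star_dotProduct, dotProduct_comm]; simp

theorem designMatrix_mulVec (π : Fin K × Fin K → ℝ) (v : Fin d → ℝ) :
    B.designMatrix π *ᵥ v =
      ∑ a, π a • ((B.φ a.1 a.2).ofLp ⬝ᵥ v) • (B.φ a.1 a.2).ofLp := by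
  simp only [designMatrix, sum_mulVec, smul_mulVec, vecMulVec_mulVec]
  refine Finset.sum_congr rfl fun a _ => ?_
  ext i
  simp

theorem dotProduct_designMatrix_mulVec (π : Fin K × Fin K → ℝ) (u v : Fin d → ℝ) :
    u ⬝ᵥ (B.designMatrix π *ᵥ v) =
      ∑ a, π a * (((B.φ a.1 a.2).ofLp ⬝ᵥ u) * ((B.φ a.1 a.2).ofLp ⬝ᵥ v)) := by
  rw [designMatrix_mulVec, dotProduct_sum]
  refine Finset.sum_congr rfl fun a _ => ?_
  rw [dotProduct_smul, dotProduct_smul, dotProduct_comm u]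
  simp only [smul_eq_mul]; ring

theorem isHermitian_designMatrix (π : Fin K × Fin K → ℝ) : (B.designMatrix π).IsHermitian := by
  ext i j
  simp [designMatrix, Matrix.sum_apply, vecMulVec_apply, mul_comm]

theorem posSemidef_designMatrix {π : Fin K × Fin K → ℝ} (hπ : ∀ a, 0 ≤ π a) :
    (B.designMatrix π).PosSemidef := by
  refine posSemidef_iff_dotProduct_mulVec.2 ⟨B.isHermitian_designMatrix π, fun v => ?_⟩
  rw [star_trivial, dotProduct_designMatrix_mulVec]
  exact Finset.sum_nonneg fun a _ => mul_nonneg (hπ a) (mul_self_nonneg _)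

/-- The determinant maximizer, found by compactness, is the competitor against which a G-optimal
design is measured. -/
theorem exists_isMaxOn_det_designMatrix [NeZero K] :
    ∃ π ∈ stdSimplex ℝ (Fin K × Fin K), ∀ π' ∈ stdSimplex ℝ (Fin K × Fin K),
      (B.designMatrix π').det ≤ (B.designMatrix π).det := by
  have hc : Continuous fun π : Fin K × Fin K → ℝ => (B.designMatrix π).det := by
    refine Continuous.matrix_det ?_
    unfold designMatrix
    exact continuous_finsetSum _ fun a _ => (continuous_apply a).smul continuous_const
  have hne : (stdSimplex ℝ (Fin K × Fin K)).Nonempty := ⟨_, single_mem_stdSimplex ℝ (0, 0)⟩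
  obtain ⟨π, hπ, hmax⟩ := (isCompact_stdSimplex ℝ (Fin K × Fin K)).exists_isMaxOn hne
    hc.continuousOn
  exact ⟨π, hπ, fun π' hπ' => hmax hπ'⟩

/-- The Kiefer–Wolfowitz bound: a design maximizing the determinant has value at most `d`. -/
theorem dotProduct_inv_mulVec_le {π : Fin K × Fin K → ℝ} (hπ : π ∈ stdSimplex ℝ (Fin K × Fin K))
    (hV : (B.designMatrix π).PosDef)
    (hmax : ∀ π' ∈ stdSimplex ℝ (Fin K × Fin K),
      (B.designMatrix π').det ≤ (B.designMatrix π).det) (a : Fin K × Fin K) :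
    (B.φ a.1 a.2).ofLp ⬝ᵥ ((B.designMatrix π)⁻¹ *ᵥ (B.φ a.1 a.2).ofLp) ≤ d := by
  refine le_of_one_add_mul_le_pow fun t ht => ?_
  have h1t : 0 < 1 + t := by linarith
  -- Mixing a little mass at `a` into `π` multiplies the determinant by `(1 + t g) / (1 + t)ᵈ`,
  -- where `g` is the quadratic form to be bounded. Maximality forces this factor to be at most one.
  set π' : Fin K × Fin K → ℝ := (1 + t)⁻¹ • (π + t • Pi.single a 1) with hπ'
  have hmem : π' ∈ stdSimplex ℝ (Fin K × Fin K) := by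
    have := convex_stdSimplex ℝ (Fin K × Fin K) hπ (single_mem_stdSimplex ℝ a)
      (a := (1 + t)⁻¹) (b := (1 + t)⁻¹ * t) (by positivity) (by positivity) (by field_simp)
    rwa [mul_smul, ← smul_add] at this
  have hmat : B.designMatrix π' = (1 + t)⁻¹ • (B.designMatrix π +
      t • vecMulVec (B.φ a.1 a.2).ofLp (B.φ a.1 a.2).ofLp) := by
    have : t • vecMulVec (B.φ a.1 a.2).ofLp (B.φ a.1 a.2).ofLp =
        ∑ b, (t • (Pi.single a 1 : Fin K × Fin K → ℝ)) b •
          vecMulVec (B.φ b.1 b.2).ofLp (B.φ b.1 b.2).ofLp := by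
      rw [Finset.sum_eq_single a]
      · simp
      · intro b _ hb; simp [hb]
      · simp
    rw [this]
    simp only [designMatrix, hπ', ← Finset.sum_add_distrib, Finset.smul_sum, Pi.smul_apply,
      Pi.add_apply, smul_assoc, add_smul]
  have h := hmax π' hmem
  rw [hmat, det_smul, det_add_smul_vecMulVec hV, Fintype.card_fin, inv_pow,
    inv_mul_le_iff₀ (by positivity), mul_comm ((1 + t) ^ d)] at h
  exact le_of_mul_le_mul_left h hV.det_pos

/-- The determinant maximizer is nonsingular because some design is, so it is an admissible
competitor, of value at most `d`. -/
theorem IsGOptimal.designValue_le [NeZero K] {π : Fin K × Fin K → ℝ} (hπ : B.IsGOptimal π) :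
    B.designValue π ≤ d := by
  obtain ⟨π', hπ', hmax⟩ := B.exists_isMaxOn_det_designMatrix
  have hpos : (B.designMatrix π').PosDef :=
    (B.posSemidef_designMatrix hπ'.1).posDef_iff_det_ne_zero.2
      (hπ.2.1.det_pos.trans_le (hmax π hπ.1)).ne'
  exact (hπ.2.2 π' hπ' hpos).trans (ciSup_le fun a => B.dotProduct_inv_mulVec_le hπ' hpos hmax a)

/-- Cauchy–Schwarz for the form of `V`, with `w = V⁻¹ u` as the dual vector of the feature `u`. -/
theorem IsGOptimal.sq_inner_le [NeZero K] {π : Fin K × Fin K → ℝ} (hπ : B.IsGOptimal π)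
    (a : Fin K × Fin K) (v : EuclideanSpace ℝ (Fin d)) :
    ⟪B.φ a.1 a.2, v⟫ ^ 2 ≤ d * ∑ b, π b * ⟪B.φ b.1 b.2, v⟫ ^ 2 := by
  simp only [inner_eq_dotProduct]
  set V := B.designMatrix π with hVdef
  set u := (B.φ a.1 a.2).ofLp
  set w := V⁻¹ *ᵥ u with hw
  have hu : V *ᵥ w = u := by
    rw [hw, mulVec_mulVec, mul_nonsing_inv _ (isUnit_iff_ne_zero.2 hπ.2.1.det_pos.ne'),
      one_mulVec]
  have hnn := hπ.1.1
  have hval : ∑ b, π b * ((B.φ b.1 b.2).ofLp ⬝ᵥ w) ^ 2 ≤ d := by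
    have h1 : u ⬝ᵥ w ≤ d :=
      (le_ciSup (f := fun a : Fin K × Fin K =>
        (B.φ a.1 a.2).ofLp ⬝ᵥ (V⁻¹ *ᵥ (B.φ a.1 a.2).ofLp)) (Set.finite_range _).bddAbove a).trans
        hπ.designValue_le
    rw [← hu, dotProduct_comm, dotProduct_designMatrix_mulVec] at h1
    simpa only [sq] using h1
  have h2 : u ⬝ᵥ v.ofLp = ∑ b, π b * (((B.φ b.1 b.2).ofLp ⬝ᵥ v.ofLp) *
      ((B.φ b.1 b.2).ofLp ⬝ᵥ w)) := by
    rw [← dotProduct_designMatrix_mulVec, hu, dotProduct_comm]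
  rw [h2]
  refine (Finset.sum_sq_le_sum_mul_sum_of_sq_le_mul Finset.univ
    (f := fun b => π b * ((B.φ b.1 b.2).ofLp ⬝ᵥ w) ^ 2)
    (g := fun b => π b * ((B.φ b.1 b.2).ofLp ⬝ᵥ v.ofLp) ^ 2)
    (fun b _ => mul_nonneg (hnn b) (sq_nonneg _)) (fun b _ => mul_nonneg (hnn b) (sq_nonneg _))
    (fun b _ => le_of_eq (by ring))).trans ?_
  exact mul_le_mul_of_nonneg_right hval
    (Finset.sum_nonneg fun b _ => mul_nonneg (hnn b) (sq_nonneg _))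

theorem IsGOptimal.sum_sq_inner_pos {π : Fin K × Fin K → ℝ} (hπ : B.IsGOptimal π)
    {v : EuclideanSpace ℝ (Fin d)} (hv : v ≠ 0) : 0 < ∑ b, π b * ⟪B.φ b.1 b.2, v⟫ ^ 2 := by
  have h := (posDef_iff_dotProduct_mulVec.1 hπ.2.1).2 (x := v.ofLp)
    (by simpa using hv)
  rw [star_trivial, dotProduct_designMatrix_mulVec] at h
  simpa only [inner_eq_dotProduct, sq] using h

theorem trace_uniformMatrix_le [NeZero K] : B.uniformMatrix.trace ≤ 1 := by
  have hK : (0 : ℝ) < K := Nat.cast_pos.2 (NeZero.pos K)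
  simp only [uniformMatrix, trace_smul, trace_sum, trace_vecMulVec, ← inner_eq_dotProduct,
    real_inner_self_eq_norm_sq, smul_eq_mul]
  rw [one_div, inv_mul_le_iff₀ (by positivity), mul_one]
  calc ∑ i, ∑ j, ‖B.φ i j‖ ^ 2 ≤ ∑ _i : Fin K, ∑ _j : Fin K, (1 : ℝ) :=
        Finset.sum_le_sum fun i _ => Finset.sum_le_sum fun j _ =>
          pow_le_one₀ (norm_nonneg _) (B.norm_φ_le i j)
    _ = (K : ℝ) ^ 2 := by simp [sq]

/-- Together with the trace bound this yields `d λ₀ ≤ 1`, which turns the factor `λ₀^{-3/2}` of the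
horizon condition into `d^{3/2}`. -/
theorem MinEigenvalueGE.mul_le_trace {lam0 : ℝ} (h : B.MinEigenvalueGE lam0) :
    d * lam0 ≤ B.uniformMatrix.trace := by
  have hH : B.uniformMatrix.IsHermitian := by
    ext i j
    simp [uniformMatrix, Matrix.sum_apply, vecMulVec_apply, mul_comm]
  rw [hH.trace_eq_sum_eigenvalues]
  calc d * lam0 = ∑ _i : Fin d, lam0 := by simp
    _ ≤ _ := Finset.sum_le_sum fun i _ => h _ (hH.eigenvalues_mem_spectrum_real i)

/-- Skewness forces `φ i i = 0`, so a single item would give the zero matrix, of trace `0 < d λ₀`.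
-/
theorem two_le_of_minEigenvalueGE [NeZero K] {lam0 : ℝ} (hd : 1 ≤ d) (h0 : 0 < lam0)
    (h : B.MinEigenvalueGE lam0) : 2 ≤ K := by
  by_contra! hK
  obtain rfl : K = 1 := by have := NeZero.pos K; omega
  have hφ : ∀ i j, B.φ i j = 0 := fun i j => by
    have := B.φ_skew i j
    rw [Subsingleton.elim j i] at this ⊢
    refine norm_eq_zero.1 ?_
    have h2 : (2 : ℝ) • B.φ i i = 0 := by
      rw [two_smul]; nth_rewrite 1 [this]; simp
    simpa using h2
  have h1 := MinEigenvalueGE.mul_le_trace B h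
  simp only [uniformMatrix, hφ] at h1
  simp at h1
  have : (1 : ℝ) ≤ d := by exact_mod_cast hd
  nlinarith

end GLMBandit

end OptimalDesign

/-! ### Law of the record and concentration of the feedback -/

section Law

variable {K d : ℕ}

/-- The first `n` rounds of a longer record. -/
def History.take {m : ℕ} (n : ℕ) (hnm : n ≤ m) (h : History K m) : History K n :=
  fun t => h (Fin.castLE hnm t)

namespace GLMBandit

variable (B : GLMBandit K d)

theorem law_succ_apply (A : Policy K) (n : ℕ) (h : History K (n + 1)) :
    B.law A (n + 1) h = B.law A n (h.take n n.le_succ) *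
      (A n (h.take n n.le_succ) (h (Fin.last n)).1 *
        B.feedback (h (Fin.last n)).1 (h (Fin.last n)).2) := by
  have hsnoc : ∀ (g : History K n) (x : Round K),
      h = Fin.snoc (α := fun _ => Round K) g x → h.take n n.le_succ = g ∧ h (Fin.last n) = x := by
    rintro g x rfl
    refine ⟨?_, by simp⟩
    funext t
    exact Fin.snoc_castSucc (α := fun _ => Round K) x g t
  have hself : h = Fin.snoc (α := fun _ => Round K) (h.take n n.le_succ) (h (Fin.last n)) :=
    (Fin.snoc_init_self (α := fun _ => Round K) h).symm
  change ((B.law A n).bind fun h => (A n h).bind fun a => (B.feedback a).bind fun r =>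
          PMF.pure (Fin.snoc (α := fun _ => Round K) h (a, r))) h = _
  simp only [PMF.bind_apply, tsum_fintype, PMF.pure_apply]
  rw [Finset.sum_eq_single (h.take n n.le_succ), Finset.sum_eq_single (h (Fin.last n)).1,
    Finset.sum_eq_single (h (Fin.last n)).2, if_pos hself, mul_one]
  · intro r _ hr
    rw [if_neg fun heq => hr (by rw [(hsnoc _ _ heq).2]), mul_zero]
  · simp
  · intro a _ ha
    rw [Finset.sum_eq_zero, mul_zero]
    intro r _
    rw [if_neg fun heq => ha (by rw [(hsnoc _ _ heq).2]), mul_zero]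
  · simp
  · intro g _ hg
    rw [Finset.sum_eq_zero, mul_zero]
    intro a _
    rw [Finset.sum_eq_zero, mul_zero]
    intro r _
    rw [if_neg fun heq => hg (hsnoc _ _ heq).1.symm, mul_zero]
  · simp

/-- Consistency of the laws: events of the exploration phase keep their probability in the full run.
-/
theorem law_map_take (A : Policy K) {n m : ℕ} (hnm : n ≤ m) :
    (B.law A m).map (History.take n hnm) = B.law A n := by
  induction m, hnm using Nat.le_induction with
  | base => exact PMF.map_id _
  | succ m hnm ih =>
    rw [← ih]
    conv_lhs => rw [law]
    simp only [PMF.map_bind, PMF.pure_map]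
    have : ∀ (h : History K m) (a : Fin K × Fin K) (r : Bool),
        History.take n (hnm.trans m.le_succ) (Fin.snoc (α := fun _ => Round K) h (a, r)) =
          h.take n hnm := by
      intro h a r
      funext t
      exact Fin.snoc_castSucc (α := fun _ => Round K) (a, r) h (Fin.castLE hnm t)
    simp only [this, PMF.bind_const]
    rfl

theorem policy_ne_zero_of_mem_support (A : Policy K) {n : ℕ} {h : History K n}
    (hh : h ∈ (B.law A n).support) (t : Fin n) :
    A t (h.take t t.isLt.le) (h t).1 ≠ 0 := by
  induction n with
  | zero => exact t.elim0
  | succ n ih =>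
    rw [PMF.mem_support_iff, law_succ_apply] at hh
    induction t using Fin.lastCases with
    | last => exact left_ne_zero_of_mul (right_ne_zero_of_mul hh)
    | cast t => exact ih (h := h.take n n.le_succ) ((PMF.mem_support_iff _ _).2
        (left_ne_zero_of_mul hh)) t

/-- If the queries do not depend on the past, the law of the record is a product. -/
theorem law_apply_of_nonadaptive (A : Policy K) (ρ : ℕ → PMF (Fin K × Fin K)) {n : ℕ}
    (hA : ∀ t < n, ∀ h, A t h = ρ t) (h : History K n) :
    B.law A n h = (∏ t : Fin n, ρ t (h t).1) * ∏ t, B.feedback (h t).1 (h t).2 := by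
  induction n with
  | zero =>
    simp only [law, Finset.univ_eq_empty, Finset.prod_empty, mul_one, PMF.pure_apply]
    rw [if_pos (Subsingleton.elim _ _)]
  | succ n ih =>
    rw [law_succ_apply, ih (fun t ht => hA t (by omega)), hA n (by omega),
      Fin.prod_univ_castSucc, Fin.prod_univ_castSucc]
    simp only [History.take, Fin.val_last, Fin.val_castSucc]
    rw [mul_mul_mul_comm]
    rfl

/-- The feedback as a real number minus its mean. -/
def noise (a : Fin K × Fin K) (r : Bool) : ℝ := (if r then 1 else 0) - B.prob a.1 a.2

/-- The probability of the feedback sequence `r` given the sequence `q` of queries. -/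
def feedbackMass {n : ℕ} (q : Fin n → Fin K × Fin K) (r : Fin n → Bool) : ℝ :=
  ∏ t, (B.feedback (q t) (r t)).toReal

theorem feedbackMass_nonneg {n : ℕ} (q : Fin n → Fin K × Fin K) (r : Fin n → Bool) :
    0 ≤ B.feedbackMass q r := Finset.prod_nonneg fun _ _ => ENNReal.toReal_nonneg

/-- Hoeffding's lemma for one round. -/
theorem sum_feedback_mul_exp_le (a : Fin K × Fin K) (s : ℝ) :
    ∑ r, (B.feedback a r).toReal * Real.exp (s * B.noise a r) ≤ Real.exp (s ^ 2 / 8) := by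
  have h0 := B.prob_nonneg a.1 a.2
  have h1 := B.prob_le_one a.1 a.2
  have hint : ∫ r, B.noise a r ∂(B.feedback a).toMeasure = 0 := by
    rw [PMF.integral_eq_sum, Fintype.sum_bool]
    have ht : ((B.feedback a) true).toReal = B.prob a.1 a.2 := by
      simp [feedback, bernoulliPMF, ENNReal.toReal_ofReal, prob, h0]
    have hf : ((B.feedback a) false).toReal = 1 - B.prob a.1 a.2 := by
      simp [feedback, bernoulliPMF, ENNReal.toReal_ofReal, prob, h1]
    rw [ht, hf]
    simp [noise]
    ring
  have hH := ProbabilityTheory.hasSubgaussianMGF_of_mem_Icc_of_integral_eq_zero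
    (μ := (B.feedback a).toMeasure) (X := B.noise a) (a := -B.prob a.1 a.2)
    (b := 1 - B.prob a.1 a.2) (Measurable.of_discrete.aemeasurable)
    (Filter.Eventually.of_forall fun r => by cases r <;> simp [noise]) hint
  have := hH.mgf_le s
  rw [ProbabilityTheory.mgf, PMF.integral_eq_sum] at this
  simp only [smul_eq_mul] at this
  refine this.trans (Real.exp_le_exp.2 (le_of_eq ?_))
  simp
  ring

theorem sum_feedbackMass_mul_exp_le {n : ℕ} (q : Fin n → Fin K × Fin K) (w : Fin n → ℝ) (s : ℝ) :
    ∑ r, B.feedbackMass q r * Real.exp (s * ∑ t, B.noise (q t) (r t) * w t) ≤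
      Real.exp (s ^ 2 * (∑ t, w t ^ 2) / 8) := by
  have h1 : ∀ r : Fin n → Bool,
      B.feedbackMass q r * Real.exp (s * ∑ t, B.noise (q t) (r t) * w t) =
      ∏ t, (B.feedback (q t) (r t)).toReal * Real.exp (s * w t * B.noise (q t) (r t)) := by
    intro r
    rw [feedbackMass, Finset.mul_sum, Real.exp_sum, ← Finset.prod_mul_distrib]
    refine Finset.prod_congr rfl fun t _ => ?_
    congr 2; ring
  simp only [h1]
  have h2 := Finset.prod_univ_sum (fun _ : Fin n => (Finset.univ : Finset Bool))
    (fun t b => (B.feedback (q t) b).toReal * Real.exp (s * w t * B.noise (q t) b))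
  rw [Fintype.piFinset_univ] at h2
  rw [← h2]
  calc _ ≤ ∏ t, Real.exp ((s * w t) ^ 2 / 8) := Finset.prod_le_prod
        (fun t _ => Finset.sum_nonneg fun b _ => by positivity)
        (fun t _ => B.sum_feedback_mul_exp_le (q t) (s * w t))
    _ = _ := by
      rw [← Real.exp_sum, ← Finset.sum_div]
      simp only [mul_pow, ← Finset.mul_sum]

/-- Hoeffding's inequality together with a union bound, for a fixed sequence of queries. -/
theorem sum_feedbackMass_le {n : ℕ} (q : Fin n → Fin K × Fin K) {I : Type*} [Fintype I]
    (w : I → Fin n → ℝ) (b σ : I → ℝ) (hσ : ∀ i, 0 < σ i)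
    (hw : ∀ i, ∑ t, w i t ^ 2 ≤ σ i ^ 2) (hb : ∀ i, 0 ≤ b i) (S : Finset (Fin n → Bool))
    (hS : ∀ r ∈ S, ∃ i, b i ≤ ∑ t, B.noise (q t) (r t) * w i t) :
    ∑ r ∈ S, B.feedbackMass q r ≤ ∑ i, Real.exp (-(2 * b i ^ 2 / σ i ^ 2)) := by
  -- The Chernoff parameter minimizing `s² σ² / 8 - s b`. On `S` at least one of the exponential
  -- factors below is at least one.
  let s : I → ℝ := fun i => 4 * b i / σ i ^ 2
  have hs : ∀ i, 0 ≤ s i := fun i => div_nonneg (by linarith [hb i]) (sq_nonneg _)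
  let e : I → (Fin n → Bool) → ℝ := fun i r =>
    Real.exp (s i * ∑ t, B.noise (q t) (r t) * w i t)
  calc ∑ r ∈ S, B.feedbackMass q r
      ≤ ∑ r ∈ S, B.feedbackMass q r * ∑ i, Real.exp (-(s i * b i)) * e i r := by
        refine Finset.sum_le_sum fun r hr => ?_
        obtain ⟨i, hi⟩ := hS r hr
        refine le_mul_of_one_le_right (B.feedbackMass_nonneg q r) ?_
        refine le_trans ?_ (Finset.single_le_sum
          (f := fun i => Real.exp (-(s i * b i)) * e i r)
          (fun i _ => by positivity) (Finset.mem_univ i))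
        simp only [e]
        rw [← Real.exp_add]
        refine Real.one_le_exp ?_
        have := mul_le_mul_of_nonneg_left hi (hs i)
        linarith
    _ ≤ ∑ r, B.feedbackMass q r * ∑ i, Real.exp (-(s i * b i)) * e i r :=
        Finset.sum_le_sum_of_subset_of_nonneg (Finset.subset_univ _) fun r _ _ =>
          mul_nonneg (B.feedbackMass_nonneg q r) (Finset.sum_nonneg fun i _ => by positivity)
    _ = ∑ i, Real.exp (-(s i * b i)) * ∑ r, B.feedbackMass q r * e i r := by
        simp only [Finset.mul_sum]
        rw [Finset.sum_comm]
        refine Finset.sum_congr rfl fun i _ => Finset.sum_congr rfl fun r _ => by ring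
    _ ≤ ∑ i, Real.exp (-(2 * b i ^ 2 / σ i ^ 2)) := by
        refine Finset.sum_le_sum fun i _ => ?_
        refine (mul_le_mul_of_nonneg_left (B.sum_feedbackMass_mul_exp_le q (w i) (s i))
          (Real.exp_pos _).le).trans ?_
        rw [← Real.exp_add, Real.exp_le_exp]
        have h1 := mul_le_mul_of_nonneg_left (hw i) (sq_nonneg (s i))
        have h2 : s i ^ 2 * σ i ^ 2 / 8 - s i * b i = -(2 * b i ^ 2 / σ i ^ 2) := by
          have := (hσ i).ne'
          simp only [s]; field_simp; ring
        linarith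

/-- An event whose conditional probability given any possible sequence of queries is at most `x` has
probability at most `x` if the queries do not depend on the past. -/
theorem law_measureReal_le_of_nonadaptive (A : Policy K) (ρ : ℕ → PMF (Fin K × Fin K)) {n : ℕ}
    (hA : ∀ t < n, ∀ h, A t h = ρ t) (bad : Set (History K n)) {x : ℝ}
    (hx : ∀ (q : Fin n → Fin K × Fin K), (∀ t : Fin n, ρ t (q t) ≠ 0) → ∀ S : Finset (Fin n → Bool),
      (∀ r ∈ S, (fun t => (q t, r t)) ∈ bad) → ∑ r ∈ S, B.feedbackMass q r ≤ x) :
    (B.law A n).toMeasure.real bad ≤ x := by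
  classical
  let e := Equiv.arrowProdEquivProdArrow (Fin n) (fun _ => Fin K × Fin K) (fun _ => Bool)
  let f : History K n → ℝ := fun h => if h ∈ bad then (B.law A n h).toReal else 0
  have h1 : (B.law A n).toMeasure.real bad = ∑ h, f h := by
    rw [MeasureTheory.measureReal_def, PMF.toMeasure_apply_fintype, ENNReal.toReal_sum]
    · refine Finset.sum_congr rfl fun h _ => ?_
      by_cases hh : h ∈ bad <;> simp [f, hh]
    · intro h _
      by_cases hh : h ∈ bad <;> simp [hh, PMF.apply_ne_top]
  have h2 : ∑ h, f h = ∑ q, ∑ r, f (e.symm (q, r)) := by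
    rw [← e.symm.sum_comp, Fintype.sum_prod_type]
  have h3 : ∀ q : Fin n → Fin K × Fin K, ∑ r, f (e.symm (q, r)) ≤
      (∏ t : Fin n, (ρ t (q t)).toReal) * x := by
    intro q
    have h4 : ∀ r, f (e.symm (q, r)) = (∏ t : Fin n, (ρ t (q t)).toReal) *
        if (fun t => (q t, r t)) ∈ bad then B.feedbackMass q r else 0 := by
      intro r
      have : e.symm (q, r) = fun t => (q t, r t) := rfl
      simp only [f, this]
      split_ifs with hb
      · rw [B.law_apply_of_nonadaptive A ρ hA, ENNReal.toReal_mul, ENNReal.toReal_prod,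
          ENNReal.toReal_prod]
        rfl
      · simp
    simp only [h4, ← Finset.mul_sum]
    -- Impossible query sequences carry no mass, so the bound is needed only where the designed
    -- queries appear as prescribed.
    by_cases hq : ∀ t : Fin n, ρ t (q t) ≠ 0
    swap
    · push Not at hq
      obtain ⟨t, ht⟩ := hq
      rw [Finset.prod_eq_zero (Finset.mem_univ t) (by rw [ht, ENNReal.toReal_zero]), zero_mul,
        zero_mul]
    refine mul_le_mul_of_nonneg_left ?_ (Finset.prod_nonneg fun _ _ => ENNReal.toReal_nonneg)
    rw [← Finset.sum_filter]
    exact hx q hq _ fun r hr => (Finset.mem_filter.1 hr).2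
  have h5 : ∑ q : Fin n → Fin K × Fin K, ∏ t : Fin n, (ρ t (q t)).toReal = 1 := by
    have h6 := Finset.prod_univ_sum (fun _ : Fin n => (Finset.univ : Finset (Fin K × Fin K)))
      (fun t a => (ρ t a).toReal)
    rw [Fintype.piFinset_univ] at h6
    rw [← h6]
    refine Finset.prod_eq_one fun t _ => ?_
    have h7 := (ρ t).tsum_coe
    rw [tsum_fintype] at h7
    rw [← ENNReal.toReal_sum fun a _ => PMF.apply_ne_top _ _, h7, ENNReal.toReal_one]
  rw [h1, h2]
  calc _ ≤ ∑ q : Fin n → Fin K × Fin K, (∏ t : Fin n, (ρ t (q t)).toReal) * x :=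
        Finset.sum_le_sum fun q _ => h3 q
    _ = x := by rw [← Finset.sum_mul, h5, one_mul]

end GLMBandit

end Law

/-! ### A finite net for the noise in a low-dimensional subspace -/

section Net

/-- The point of the grid `{-1, -1 + 1/d, …, 1}ᵐ` with index `c`. -/
def gridPoint (d : ℕ) {m : ℕ} (c : Fin m → Fin (2 * d + 1)) : EuclideanSpace ℝ (Fin m) :=
  WithLp.toLp 2 fun i => ((c i : ℕ) - d : ℝ) / d

/-- Rounding each coordinate to the nearest multiple of `1/d` costs at most `1/(2d)`, and at most
`d` coordinates add up to a squared error of `1/4`. -/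
theorem exists_gridPoint_near {m d : ℕ} (hm : m ≤ d) (hd : 1 ≤ d)
    (u : EuclideanSpace ℝ (Fin m)) (hu : ‖u‖ ≤ 1) :
    ∃ c : Fin m → Fin (2 * d + 1), ‖gridPoint d c - u‖ ≤ 1 / 2 := by
  have hd1 : (1 : ℝ) ≤ d := by exact_mod_cast hd
  have hd0 : (0 : ℝ) < d := by linarith
  have hui : ∀ i, |u i| ≤ 1 := fun i => (PiLp.norm_apply_le u i).trans hu
  have hnn : ∀ i, 0 ≤ d * u i + d + 1 / 2 := fun i => by nlinarith [(abs_le.1 (hui i)).1]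
  have hlt : ∀ i, ⌊d * u i + d + 1 / 2⌋₊ < 2 * d + 1 := fun i => by
    rw [Nat.floor_lt (hnn i)]
    push_cast
    nlinarith [(abs_le.1 (hui i)).2]
  refine ⟨fun i => ⟨⌊d * u i + d + 1 / 2⌋₊, hlt i⟩, ?_⟩
  refine abs_le_of_sq_le_sq' ?_ (by norm_num) |>.2
  rw [EuclideanSpace.norm_sq_eq]
  have hterm : ∀ i, ‖(gridPoint d (fun i => ⟨⌊d * u i + d + 1 / 2⌋₊, hlt i⟩) - u) i‖ ^ 2 ≤
      1 / (4 * d ^ 2) := by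
    intro i
    have h1 := Nat.floor_le (hnn i)
    have h2 := Nat.lt_floor_add_one (d * u i + d + 1 / 2)
    set f : ℝ := (⌊d * u i + d + 1 / 2⌋₊ : ℝ)
    have h3 : (gridPoint d (fun i => ⟨⌊d * u i + d + 1 / 2⌋₊, hlt i⟩) - u) i =
        (f - d - d * u i) / d := by
      change (f - d) / d - u i = _
      field_simp
    rw [h3, Real.norm_eq_abs, sq_abs, div_pow, div_le_div_iff₀ (by positivity) (by positivity)]
    have h4 : (f - d - d * u i) ^ 2 ≤ (1 / 2) ^ 2 := sq_le_sq' (by linarith) (by linarith)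
    nlinarith [sq_nonneg (d : ℝ)]
  calc _ ≤ ∑ _i : Fin m, (1 : ℝ) / (4 * d ^ 2) := Finset.sum_le_sum fun i _ => hterm i
    _ = m / (4 * d ^ 2) := by simp [div_eq_mul_inv]
    _ ≤ d / (4 * d ^ 2) := by gcongr
    _ ≤ (1 / 2) ^ 2 := by
      rw [div_le_iff₀ (by positivity)]
      nlinarith

/-- A grid point within `1/2` of the unit vector along `y` has inner product at least `‖y‖ / 2` with
`y`. -/
theorem norm_le_of_gridPoint {m d : ℕ} (hm : m ≤ d) (hd : 1 ≤ d)
    (y : EuclideanSpace ℝ (Fin m)) {r : ℝ}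
    (h : ∀ c : Fin m → Fin (2 * d + 1), ‖gridPoint d c‖ ≤ 3 / 2 → ⟪gridPoint d c, y⟫ ≤ r) :
    ‖y‖ ≤ 2 * r := by
  obtain ⟨u, hu, huy⟩ : ∃ u : EuclideanSpace ℝ (Fin m), ‖u‖ ≤ 1 ∧ ⟪u, y⟫ = ‖y‖ := by
    rcases eq_or_ne y 0 with rfl | hy
    · exact ⟨0, by simp, by simp⟩
    · have : ‖y‖ ≠ 0 := norm_ne_zero_iff.2 hy
      refine ⟨‖y‖⁻¹ • y, ?_, ?_⟩
      · rw [norm_smul, norm_inv, norm_norm, inv_mul_cancel₀ this]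
      · rw [real_inner_smul_left, real_inner_self_eq_norm_sq]; field_simp
  obtain ⟨c, hc⟩ := exists_gridPoint_near hm hd u hu
  have h1 : ‖gridPoint d c‖ ≤ 3 / 2 := by
    have := norm_add_le (gridPoint d c - u) u
    rw [sub_add_cancel] at this
    linarith
  have h2 := h c h1
  have h3 : ⟪gridPoint d c, y⟫ = ‖y‖ + ⟪gridPoint d c - u, y⟫ := by
    rw [inner_sub_left, huy]; ring
  have h4 := abs_real_inner_le_norm (gridPoint d c - u) y
  have h5 := (abs_le.1 h4).1
  nlinarith [norm_nonneg y]

/-- A finite set of vectors that controls the inner products with a low-dimensional subspace. -/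
theorem exists_finset_inner_le {F : Type*} [NormedAddCommGroup F] [InnerProductSpace ℝ F]
    [FiniteDimensional ℝ F] (U : Submodule ℝ F) {d : ℕ} (hU : Module.finrank ℝ U ≤ d)
    (hd : 1 ≤ d) :
    ∃ W : Finset F, W.card ≤ (2 * d + 1) ^ d ∧ (∀ w ∈ W, ‖w‖ ≤ 3 / 2) ∧
      ∀ (y : F) (r : ℝ), (∀ w ∈ W, ⟪w, y⟫ ≤ r) → ∀ u ∈ U, ⟪u, y⟫ ≤ 2 * r * ‖u‖ := by
  classical
  set m := Module.finrank ℝ U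
  -- An orthonormal basis carries the grid isometrically into `U`.
  let b := stdOrthonormalBasis ℝ U
  let T : EuclideanSpace ℝ (Fin m) → F := fun a => (b.repr.symm a : U)
  have hTn : ∀ a, ‖T a‖ = ‖a‖ := fun a => b.repr.symm.norm_map a
  have hTi : ∀ a y, ⟪T a, y⟫ =
      ⟪a, (WithLp.toLp 2 fun i => ⟪(b i : F), y⟫ : EuclideanSpace ℝ (Fin m))⟫ := by
    intro a y
    have : T a = ∑ i, a i • (b i : F) := by
      simp only [T]
      rw [← b.sum_repr_symm a]
      simp only [Submodule.coe_sum, Submodule.coe_smul]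
      rfl
    rw [this, sum_inner, PiLp.inner_apply]
    refine Finset.sum_congr rfl fun i _ => ?_
    rw [real_inner_smul_left]
    simp [mul_comm]
  refine ⟨(Finset.univ.filter fun c : Fin m → Fin (2 * d + 1) =>
    ‖gridPoint d c‖ ≤ 3 / 2).image fun c => T (gridPoint d c), ?_, ?_, ?_⟩
  · refine Finset.card_image_le.trans ((Finset.card_filter_le _ _).trans ?_)
    rw [Finset.card_univ, Fintype.card_fun, Fintype.card_fin, Fintype.card_fin]
    exact Nat.pow_le_pow_right (by omega) hU
  · intro w hw
    obtain ⟨c, hc, rfl⟩ := Finset.mem_image.1 hw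
    rw [hTn]
    exact (Finset.mem_filter.1 hc).2
  · intro y r hy u hu
    have h1 := norm_le_of_gridPoint hU hd
      (WithLp.toLp 2 fun i => ⟪(b i : F), y⟫ : EuclideanSpace ℝ (Fin m)) (r := r) fun c hc => by
        rw [← hTi]
        exact hy _ (Finset.mem_image_of_mem _ (Finset.mem_filter.2 ⟨Finset.mem_univ _, hc⟩))
    have h2 : u = T (b.repr ⟨u, hu⟩) := by simp [T]
    rw [h2, hTn, hTi, mul_comm (2 * r)]
    exact (real_inner_le_norm _ _).trans (mul_le_mul_of_nonneg_left h1 (norm_nonneg _))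

end Net

/-! ### Cost and precision of the rounded design -/

section DesignedQueries

variable {K d : ℕ}

theorem sum_map_designedQueries (π : Fin K × Fin K → ℝ) (ε : ℝ) {R : Type*} [Semiring R]
    (f : Fin K × Fin K → R) :
    ((designedQueries d π ε).map f).sum = ∑ a, (⌈(d : ℝ) * π a / ε ^ 2⌉₊ : R) * f a := by
  have hflat : ∀ (g : Fin K → List R),
      ((List.finRange K).flatMap g).sum = ∑ i, (g i).sum := by
    intro g
    rw [List.flatMap, List.sum_flatten, List.map_map, ← List.ofFn_eq_map, List.sum_ofFn]
    rfl
  rw [designedQueries, List.map_flatMap, hflat, Fintype.sum_prod_type]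
  refine Finset.sum_congr rfl fun i _ => ?_
  rw [List.map_flatMap, hflat]
  refine Finset.sum_congr rfl fun j _ => ?_
  rw [List.map_replicate, List.sum_replicate, nsmul_eq_mul]

theorem length_designedQueries (π : Fin K × Fin K → ℝ) (ε : ℝ) :
    (designedQueries d π ε).length = ∑ a, ⌈(d : ℝ) * π a / ε ^ 2⌉₊ := by
  have h := sum_map_designedQueries (d := d) π ε (fun _ => (1 : ℕ))
  simpa using h

/-- Rounding up costs at most one query per support point and none off the support. -/
theorem length_designedQueries_le {π : Fin K × Fin K → ℝ}
    (hπ : π ∈ stdSimplex ℝ (Fin K × Fin K)) {N : ℕ}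
    (hN : (Finset.univ.filter fun a => π a ≠ 0).card ≤ N) (ε : ℝ) :
    ((designedQueries d π ε).length : ℝ) ≤ d / ε ^ 2 + N := by
  have hnn : ∀ a, 0 ≤ (d : ℝ) * π a / ε ^ 2 := fun a =>
    div_nonneg (mul_nonneg d.cast_nonneg (hπ.1 a)) (sq_nonneg _)
  rw [length_designedQueries, Nat.cast_sum]
  calc ∑ a, (⌈(d : ℝ) * π a / ε ^ 2⌉₊ : ℝ)
      ≤ ∑ a, ((d : ℝ) * π a / ε ^ 2 + if π a ≠ 0 then 1 else 0) := by
        refine Finset.sum_le_sum fun a _ => ?_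
        split_ifs with h
        · exact (Nat.ceil_lt_add_one (hnn a)).le
        · simp [not_not.1 h]
    _ = d / ε ^ 2 + ((Finset.univ.filter fun a => π a ≠ 0).card : ℝ) := by
        rw [Finset.sum_add_distrib, ← Finset.sum_div, ← Finset.mul_sum, hπ.2, mul_one,
          Finset.sum_boole]
    _ ≤ d / ε ^ 2 + N := by gcongr

/-- Queries that end with the designed ones determine every feature direction up to `ε`. -/
theorem GLMBandit.IsGOptimal.abs_inner_le [NeZero K] (B : GLMBandit K d)
    {π : Fin K × Fin K → ℝ} (hπ : B.IsGOptimal π) {τ : ℕ} {ε : ℝ} (hε : 0 < ε)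
    (q : Fin (τ + (designedQueries d π ε).length) → Fin K × Fin K)
    (hq : ∀ t, q (Fin.natAdd τ t) = (designedQueries d π ε)[(t : ℕ)])
    (a : Fin K × Fin K) (v : EuclideanSpace ℝ (Fin d)) :
    |⟪B.φ a.1 a.2, v⟫| ≤ ε * ‖queryMap (fun t => B.φ (q t).1 (q t).2) v‖ := by
  refine abs_le_of_sq_le_sq ?_ (by positivity)
  rw [mul_pow, norm_queryMap_sq, Fin.sum_univ_add]
  refine (IsGOptimal.sq_inner_le B hπ a v).trans ?_
  simp only [hq]
  rw [Fin.sum_univ_fun_getElem _ fun b : Fin K × Fin K => ⟪B.φ b.1 b.2, v⟫ ^ 2,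
    sum_map_designedQueries]
  -- The uniform rounds contribute nonnegatively and are dropped.
  have h1 : 0 ≤ ∑ i, ⟪B.φ (q (Fin.castAdd (designedQueries d π ε).length i)).1
      (q (Fin.castAdd (designedQueries d π ε).length i)).2, v⟫ ^ 2 :=
    Finset.sum_nonneg fun _ _ => sq_nonneg _
  have h2 : (d : ℝ) * ∑ b, π b * ⟪B.φ b.1 b.2, v⟫ ^ 2 ≤
      ε ^ 2 * ∑ b, (⌈(d : ℝ) * π b / ε ^ 2⌉₊ : ℝ) * ⟪B.φ b.1 b.2, v⟫ ^ 2 := by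
    rw [Finset.mul_sum, Finset.mul_sum]
    refine Finset.sum_le_sum fun b _ => ?_
    rw [← mul_assoc, ← mul_assoc]
    refine mul_le_mul_of_nonneg_right ?_ (sq_nonneg _)
    have h3 := Nat.le_ceil ((d : ℝ) * π b / ε ^ 2)
    rw [div_le_iff₀ (by positivity)] at h3
    linarith
  nlinarith [mul_nonneg (sq_nonneg ε) h1]

theorem GLMBandit.IsGOptimal.injective_queryMap [NeZero K] (B : GLMBandit K d)
    {π : Fin K × Fin K → ℝ} (hπ : B.IsGOptimal π) {ι : Type*} [Fintype ι] {ε : ℝ}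
    (x : ι → EuclideanSpace ℝ (Fin d))
    (hx : ∀ (a : Fin K × Fin K) v, |⟪B.φ a.1 a.2, v⟫| ≤ ε * ‖queryMap x v‖) :
    Function.Injective (queryMap x) := by
  refine (injective_iff_map_eq_zero _).2 fun v hv => ?_
  by_contra hne
  refine (IsGOptimal.sum_sq_inner_pos B hπ hne).ne' (Finset.sum_eq_zero fun a _ => ?_)
  have := hx a v
  rw [hv, norm_zero, mul_zero] at this
  rw [abs_nonpos_iff.1 this]
  simp

end DesignedQueries

/-! ### From prediction errors to Borda scores and regret -/

section Link

namespace GLMBandit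

variable {K d : ℕ} (B : GLMBandit K d)

theorem kappa_le_deriv (i j : Fin K) : B.kappa ≤ deriv B.μ ⟪B.φ i j, B.θstar⟫ := by
  refine csInf_le ⟨0, ?_⟩ ⟨(B.φ i j, B.θstar), ⟨B.norm_φ_le i j, by simp⟩, rfl⟩
  rintro _ ⟨q, -, rfl⟩
  exact B.μ_mono.deriv_nonneg

theorem SmoothLink.abs_deriv_sub_le {L M : ℝ} (h : B.SmoothLink L M) (x y : ℝ) :
    |deriv B.μ x - deriv B.μ y| ≤ M * |x - y| :=
  Convex.norm_image_sub_le_of_norm_deriv_le (f := deriv B.μ) (s := Set.univ)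
    (fun x _ => h.2.1 x) (fun x _ => h.2.2.2 x) convex_univ trivial trivial

theorem SmoothLink.abs_sub_le {L M : ℝ} (h : B.SmoothLink L M) (x y : ℝ) :
    |B.μ x - B.μ y| ≤ L * |x - y| :=
  Convex.norm_image_sub_le_of_norm_deriv_le (f := B.μ) (s := Set.univ)
    (fun x _ => h.1 x) (fun x _ => h.2.2.1 x) convex_univ trivial trivial

theorem borda_nonneg (i : Fin K) : 0 ≤ B.borda i :=
  mul_nonneg (by positivity) (Finset.sum_nonneg fun j _ => B.prob_nonneg i j)

theorem borda_le_one [NeZero K] (i : Fin K) : B.borda i ≤ 1 := by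
  have hK : (0 : ℝ) < K := Nat.cast_pos.2 (NeZero.pos K)
  rw [borda, one_div, inv_mul_le_iff₀ hK, mul_one]
  calc ∑ j, B.prob i j ≤ ∑ _j : Fin K, (1 : ℝ) :=
        Finset.sum_le_sum fun j _ => B.prob_le_one i j
    _ = K := by simp

theorem abs_estBorda_sub_borda_le [NeZero K] {L M m : ℝ} (h : B.SmoothLink L M) (hL : 0 ≤ L)
    {θ : EuclideanSpace ℝ (Fin d)}
    (hθ : ∀ a : Fin K × Fin K, |⟪B.φ a.1 a.2, θ - B.θstar⟫| ≤ m) (i : Fin K) :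
    |B.estBorda θ i - B.borda i| ≤ L * m := by
  have hK : (0 : ℝ) < K := Nat.cast_pos.2 (NeZero.pos K)
  rw [estBorda, borda, ← mul_sub, ← Finset.sum_sub_distrib, abs_mul, one_div,
    abs_of_pos (inv_pos.2 hK), inv_mul_le_iff₀ hK]
  calc |∑ j, (B.μ ⟪B.φ i j, θ⟫ - B.prob i j)|
      ≤ ∑ j, |B.μ ⟪B.φ i j, θ⟫ - B.prob i j| := Finset.abs_sum_le_sum_abs _ _
    _ ≤ ∑ _j : Fin K, L * m := by
        refine Finset.sum_le_sum fun j _ => (SmoothLink.abs_sub_le B h _ _).trans ?_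
        rw [← inner_sub_right]
        exact mul_le_mul_of_nonneg_left (hθ (i, j)) hL
    _ = K * (L * m) := by simp

/-- The estimated score errs by at most `L m` at the winner and at `k`, and `k` beats the winner in
estimated score. -/
theorem iSup_borda_sub_le [NeZero K] {L M m : ℝ} (h : B.SmoothLink L M) (hL : 0 ≤ L)
    {θ : EuclideanSpace ℝ (Fin d)}
    (hθ : ∀ a : Fin K × Fin K, |⟪B.φ a.1 a.2, θ - B.θstar⟫| ≤ m) {k : Fin K}
    (hk : ∀ i, B.estBorda θ i ≤ B.estBorda θ k) :
    (⨆ i, B.borda i) - B.borda k ≤ 2 * (L * m) := by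
  have h1 := abs_le.1 (B.abs_estBorda_sub_borda_le h hL hθ k)
  have : (⨆ i, B.borda i) ≤ B.borda k + 2 * (L * m) := ciSup_le fun i => by
    have h2 := abs_le.1 (B.abs_estBorda_sub_borda_le h hL hθ i)
    linarith [hk i, h1.2, h2.1]
  linarith

theorem instantaneous_regret_le_two [NeZero K] (a : Fin K × Fin K) :
    2 * (⨆ i, B.borda i) - B.borda a.1 - B.borda a.2 ≤ 2 := by
  have : (⨆ i, B.borda i) ≤ 1 := ciSup_le B.borda_le_one
  linarith [B.borda_nonneg a.1, B.borda_nonneg a.2]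

theorem regret_le_two_mul [NeZero K] {n : ℕ} (h : History K n) : B.regret h ≤ 2 * n := by
  calc B.regret h ≤ ∑ _t : Fin n, (2 : ℝ) :=
        Finset.sum_le_sum fun t _ => B.instantaneous_regret_le_two (h t).1
    _ = 2 * n := by simp [mul_comm]

/-- The regret of a record in which the pair `(k, k)` is queried from round `n` on. -/
theorem regret_le_of_commit [NeZero K] {n T : ℕ} (h : History K T) {k : Fin K} {g : ℝ}
    (hg : 0 ≤ g) (hk : (⨆ i, B.borda i) - B.borda k ≤ g)
    (hc : ∀ t : Fin T, n ≤ t → (h t).1 = (k, k)) : B.regret h ≤ 2 * n + T * (2 * g) := by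
  calc B.regret h ≤ ∑ t : Fin T, ((if (t : ℕ) < n then 2 else 0) + 2 * g) := by
        refine Finset.sum_le_sum fun t _ => ?_
        split_ifs with ht
        · linarith [B.instantaneous_regret_le_two (h t).1]
        · rw [hc t (not_lt.1 ht)]
          simp only
          linarith
    _ = 2 * ((Finset.univ.filter fun t : Fin T => (t : ℕ) < n).card : ℝ) + T * (2 * g) := by
        rw [Finset.sum_add_distrib, ← Finset.sum_filter]
        simp [mul_comm]
    _ ≤ 2 * n + T * (2 * g) := by
        have : (Finset.univ.filter fun t : Fin T => (t : ℕ) < n).card ≤ n := by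
          rw [Fin.card_filter_val_lt]
          exact min_le_right _ _
        have : ((Finset.univ.filter fun t : Fin T => (t : ℕ) < n).card : ℝ) ≤ n := by
          exact_mod_cast this
        linarith

end GLMBandit

end Link

/-! ### Probability of an accurate estimator -/

section GoodEvent

namespace GLMBandit

variable {K d : ℕ} (B : GLMBandit K d)

/-- The likelihood equation of the record `h` has a solution, and all its solutions predict the
features up to an error of `m`. -/
def AccurateMLE {n : ℕ} (h : History K n) (m : ℝ) : Prop :=
  (∃ θ, B.IsMLE h θ) ∧ ∀ θ, B.IsMLE h θ →
    ∀ a : Fin K × Fin K, |⟪B.φ a.1 a.2, θ - B.θstar⟫| ≤ m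

/-- The net has at most `exp(2d²)` points, and the exponent `32/9 (d² + l)` pays for them: this is
why the threshold contains `d²`. -/
theorem two_mul_add_one_pow_mul_exp_le {d : ℕ} {l : ℝ} (hl : 0 ≤ l) :
    ((2 * d + 1) ^ d : ℝ) * Real.exp (-(2 * (2 * √(d ^ 2 + l)) ^ 2 / (3 / 2) ^ 2)) ≤
      Real.exp (-l) := by
  have h1 : ((2 * d + 1) ^ d : ℝ) ≤ Real.exp (d * (2 * d)) := by
    rw [Real.exp_nat_mul]
    exact pow_le_pow_left₀ (by positivity) (Real.add_one_le_exp _) _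
  refine (mul_le_mul_of_nonneg_right h1 (Real.exp_pos _).le).trans ?_
  rw [← Real.exp_add, Real.exp_le_exp, mul_pow, Real.sq_sqrt (by positivity)]
  have : 2 * (2 ^ 2 * ((d : ℝ) ^ 2 + l)) / (3 / 2) ^ 2 = 32 / 9 * ((d : ℝ) ^ 2 + l) := by ring
  nlinarith [sq_nonneg (d : ℝ)]

theorem sum_feedbackMass_not_accurateMLE_le [NeZero K] {L M l ε : ℝ} (hd : 1 ≤ d)
    (hκ : 0 < B.kappa) (hμ : B.SmoothLink L M) (hM : 0 ≤ M) (hε : 0 < ε) (hl : 0 ≤ l) {n : ℕ}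
    (q : Fin n → Fin K × Fin K)
    (hx : ∀ (a : Fin K × Fin K) v,
      |⟪B.φ a.1 a.2, v⟫| ≤ ε * ‖queryMap (fun t => B.φ (q t).1 (q t).2) v‖)
    (hinj : Function.Injective (queryMap fun t => B.φ (q t).1 (q t).2))
    (hsmall : 8 * M * (4 * √(d ^ 2 + l)) * ε ≤ B.kappa ^ 2) (S : Finset (Fin n → Bool))
    (hS : ∀ r ∈ S, ¬ B.AccurateMLE (fun t => (q t, r t)) (2 * (ε / B.kappa * √l))) :
    ∑ r ∈ S, B.feedbackMass q r ≤ (2 * K ^ 2 + 1) * Real.exp (-l) := by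
  classical
  set x : Fin K × Fin K → EuclideanSpace ℝ (Fin d) := fun a => B.φ a.1 a.2 with hxdef
  set A := queryMap fun t => x (q t) with hA
  have hd1 : (1 : ℝ) ≤ d := by exact_mod_cast hd
  have hκt : ∀ t, B.kappa ≤ deriv B.μ ⟪x (q t), B.θstar⟫ := fun t => B.kappa_le_deriv _ _
  have hdual := fun a => exists_dual_vector (fun t => x (q t)) hinj
    (fun t => deriv B.μ ⟪x (q t), B.θstar⟫) (fun t => hκ.trans_le (hκt t)) (x a)
  choose w hw using hdual
  have hwn : ∀ a, ‖A (w a)‖ ≤ ε / B.kappa := fun a =>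
    norm_queryMap_dual_le (fun t => x (q t)) _ hκ hε.le hκt (hx a) (hw a)
  obtain ⟨W, hWcard, hWn, hW⟩ := exists_finset_inner_le (LinearMap.range A)
    ((LinearMap.finrank_range_le A).trans (by simp)) hd
  -- The test vectors of the union bound: both signs of each dual vector, of norm at most `ε / κ`,
  -- and the net of the range, of norms at most `3/2`.
  let v : ((Fin K × Fin K) × Bool) ⊕ W → Fin n → ℝ := Sum.elim
    (fun p t => (if p.2 then 1 else -1) * ⟪x (q t), w p.1⟫) (fun u t => (u : EuclideanSpace ℝ _) t)
  let b : ((Fin K × Fin K) × Bool) ⊕ W → ℝ := Sum.elim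
    (fun _ => ε / B.kappa * √l) (fun _ => 2 * √(d ^ 2 + l))
  let σ : ((Fin K × Fin K) × Bool) ⊕ W → ℝ := Sum.elim
    (fun _ => ε / B.kappa) (fun _ => 3 / 2)
  have hεκ : 0 < ε / B.kappa := div_pos hε hκ
  have hmass := B.sum_feedbackMass_le q v b σ
    (by rintro (p | u) <;> simp only [σ, Sum.elim_inl, Sum.elim_inr] <;> positivity)
    (by
      rintro (p | u)
      · simp only [v, σ, Sum.elim_inl, mul_pow]
        have h1 : ((if p.2 then 1 else -1 : ℝ)) ^ 2 = 1 := by split_ifs <;> norm_num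
        rw [h1]
        simp only [one_mul]
        rw [← norm_queryMap_sq]
        exact pow_le_pow_left₀ (norm_nonneg _) (hwn p.1) 2
      · simp only [v, σ, Sum.elim_inr]
        have := pow_le_pow_left₀ (norm_nonneg _) (hWn u u.2) 2
        rw [EuclideanSpace.norm_sq_eq] at this
        simpa using this)
    (by rintro (p | u) <;> simp only [b, Sum.elim_inl, Sum.elim_inr] <;> positivity)
    S (by
      intro r hr
      by_contra! hlt
      refine hS r hr ?_
      have hmean : ∀ t, (if r t then (1 : ℝ) else 0) - B.μ ⟪x (q t), B.θstar⟫ =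
          B.noise (q t) (r t) := fun t => rfl
      -- Passing from the net to the whole range doubles the threshold `2√(d² + l)`.
      refine abs_inner_score_zero_le (N := 4 * √(d ^ 2 + l)) B.μ_mono hμ.1
        (SmoothLink.abs_deriv_sub_le B hμ) hM hε.le hκ (by positivity) x q B.θstar
        (fun t => if r t then (1 : ℝ) else 0) hκt hx hinj hsmall ?_ w hw ?_
      · intro z
        simp only [hmean]
        let y : EuclideanSpace ℝ (Fin n) := WithLp.toLp 2 fun t => B.noise (q t) (r t)
        have hWy : ∀ u ∈ W, ⟪u, y⟫ ≤ 2 * √(d ^ 2 + l) := by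
          intro u hu
          have := (hlt (Sum.inr ⟨u, hu⟩)).le
          simp only [v, b, Sum.elim_inr] at this
          rw [PiLp.inner_apply]
          exact this
        have h2 := hW y _ hWy (A z) (LinearMap.mem_range_self A z)
        rw [PiLp.inner_apply] at h2
        refine le_trans (le_of_eq ?_) (h2.trans (le_of_eq (by ring)))
        rfl
      · intro a
        simp only [hmean]
        have h3 := (hlt (Sum.inl (a, true))).le
        have h4 := (hlt (Sum.inl (a, false))).le
        simp only [v, b, Sum.elim_inl, if_true, one_mul] at h3
        simp only [v, b, Sum.elim_inl, Bool.false_eq_true, if_false, neg_mul, one_mul, mul_neg,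
          Finset.sum_neg_distrib] at h4
        exact abs_le.2 ⟨by linarith, h3⟩)
  refine hmass.trans ?_
  rw [Fintype.sum_sum_type]
  simp only [b, σ, Sum.elim_inl, Sum.elim_inr, Finset.sum_const, Finset.card_univ,
    Fintype.card_prod, Fintype.card_fin, Fintype.card_bool, nsmul_eq_mul, Fintype.card_coe]
  have h5 : Real.exp (-(2 * (ε / B.kappa * √l) ^ 2 / (ε / B.kappa) ^ 2)) ≤ Real.exp (-l) := by
    rw [Real.exp_le_exp, mul_pow, Real.sq_sqrt hl]
    have : 2 * ((ε / B.kappa) ^ 2 * l) / (ε / B.kappa) ^ 2 = 2 * l := by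
      have := hεκ.ne'; field_simp
    rw [this]; linarith
  have h6 : (W.card : ℝ) * Real.exp (-(2 * (2 * √(d ^ 2 + l)) ^ 2 / (3 / 2) ^ 2)) ≤
      Real.exp (-l) := by
    refine le_trans (mul_le_mul_of_nonneg_right ?_ (Real.exp_pos _).le)
      (two_mul_add_one_pow_mul_exp_le hl)
    exact_mod_cast hWcard
  push_cast
  have h7 := mul_le_mul_of_nonneg_left h5 (show (0 : ℝ) ≤ K * K * 2 by positivity)
  calc _ ≤ K * K * 2 * Real.exp (-l) + Real.exp (-l) := add_le_add h7 h6
    _ = _ := by ring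

end GLMBandit

end GoodEvent

/-! ### Regret of explore-then-commit -/

section ExploreThenCommit

variable {K d : ℕ} [NeZero K]

theorem etcPolicy_explore (τ : ℕ) (l : List (Fin K × Fin K))
    (commit : History K (τ + l.length) → Fin K) :
    ∃ ρ : ℕ → PMF (Fin K × Fin K), (∀ t < τ + l.length, ∀ h, etcPolicy τ l commit t h = ρ t) ∧
      ∀ q : Fin (τ + l.length) → Fin K × Fin K, (∀ t : Fin (τ + l.length), ρ t (q t) ≠ 0) →
        ∀ t, q (Fin.natAdd τ t) = l[(t : ℕ)] := by
  -- The last branch is a filler for rounds after exploration.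
  refine ⟨fun t => if t < τ then PMF.uniformOfFintype (Fin K × Fin K)
    else if h : t - τ < l.length then PMF.pure l[t - τ] else PMF.pure 0, ?_, ?_⟩
  · intro t ht h
    simp only [etcPolicy]
    split_ifs with h1 h2
    · rfl
    · rfl
    · omega
  · intro q hq t
    have h1 := hq (Fin.natAdd τ t)
    simp only [Fin.val_natAdd, add_lt_iff_neg_left, not_lt_zero, if_false,
      add_tsub_cancel_left, t.isLt, dif_pos] at h1
    by_contra hne
    exact h1 (PMF.pure_apply_of_ne _ _ hne)

theorem etcPolicy_commit (τ : ℕ) (l : List (Fin K × Fin K))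
    (commit : History K (τ + l.length) → Fin K) {n : ℕ} (hn : τ + l.length ≤ n) (h : History K n) :
    etcPolicy τ l commit n h = PMF.pure (commit (h.take _ hn), commit (h.take _ hn)) := by
  simp only [etcPolicy]
  rw [dif_neg (by omega), dif_neg (by omega)]
  rfl

namespace GLMBandit

variable (B : GLMBandit K d)

/-- Regret of an explore-then-commit algorithm in terms of the failure probability of the
exploration phase. -/
theorem law_regret_gt_le_of_etc (τ : ℕ) (l : List (Fin K × Fin K))
    (commit : History K (τ + l.length) → Fin K) (T : ℕ) {g R x : ℝ} (hg : 0 ≤ g) (hx : 0 ≤ x)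
    (hR : 2 * ((τ + l.length : ℕ) : ℝ) + T * (2 * g) ≤ R)
    (hbad : (B.law (etcPolicy τ l commit) (τ + l.length)).toMeasure.real
      {h | ¬ (⨆ i, B.borda i) - B.borda (commit h) ≤ g} ≤ x) :
    (B.law (etcPolicy τ l commit) T).toMeasure.real {h | R < B.regret h} ≤ x := by
  -- If the horizon ends during exploration, the trivial bound `2T` is already below `R`.
  rcases lt_or_ge T (τ + l.length) with hT | hT
  · have hempty : {h : History K T | R < B.regret h} = ∅ := by
      refine Set.eq_empty_of_forall_notMem fun h hh => ?_
      have h1 := B.regret_le_two_mul h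
      have h2 : (T : ℝ) ≤ ((τ + l.length : ℕ) : ℝ) := by exact_mod_cast hT.le
      have h3 : 0 ≤ (T : ℝ) * (2 * g) := by positivity
      have : R < B.regret h := hh
      linarith
    rw [hempty, MeasureTheory.measureReal_empty]
    exact hx
  refine le_trans ?_ hbad
  rw [← B.law_map_take _ hT, MeasureTheory.measureReal_def, MeasureTheory.measureReal_def,
    PMF.toMeasure_map_apply _ _ _ Measurable.of_discrete (Set.toFinite _).measurableSet]
  refine ENNReal.toReal_mono (MeasureTheory.measure_ne_top _ _)
    (PMF.toMeasure_mono _ (Set.toFinite _).measurableSet ?_)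
  rintro h ⟨hreg, hsupp⟩
  simp only [Set.mem_preimage, Set.mem_ofPred_eq] at hreg ⊢
  intro hgap
  -- On records of positive probability every later query is the committed pair.
  have h4 := B.regret_le_of_commit (n := τ + l.length) h hg hgap (by
    intro t ht
    have h5 := B.policy_ne_zero_of_mem_support _ hsupp t
    rw [etcPolicy_commit τ l commit ht] at h5
    by_contra hne
    exact h5 (PMF.pure_apply_of_ne _ _ hne))
  linarith

/-- The regret of BETC-GLM in terms of its parameters. -/
theorem law_regret_gt_le {L M l ε R x : ℝ} {τ T N : ℕ} {A : Policy K}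
    (hd : 1 ≤ d)
    (hκ : 0 < B.kappa) (hμ : B.SmoothLink L M) (hL : 0 ≤ L) (hM : 0 ≤ M) (hε : 0 < ε)
    (hl : 0 ≤ l) (hA : IsBETCGLM B τ ε A) (hN : d * (d + 1) / 2 ≤ N)
    (hsmall : 8 * M * (4 * √(d ^ 2 + l)) * ε ≤ B.kappa ^ 2)
    (hx : (2 * K ^ 2 + 1) * Real.exp (-l) ≤ x)
    (hR : 2 * (τ + (d / ε ^ 2 + N)) + T * (2 * (2 * (L * (2 * (ε / B.kappa * √l))))) ≤ R) :
    (B.law A T).toMeasure.real {h | R < B.regret h} ≤ x := by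
  obtain ⟨π, hπ, hcard, θhat, ihat, hθ, hi, rfl⟩ := hA
  have hx0 : 0 ≤ x := le_trans (by positivity) hx
  refine B.law_regret_gt_le_of_etc τ _ ihat T (g := 2 * (L * (2 * (ε / B.kappa * √l))))
    (by positivity) hx0 ?_ ?_
  · have := length_designedQueries_le hπ.1 (d := d) (hcard.trans hN) ε
    push_cast
    linarith
  · obtain ⟨ρ, hρ, hq⟩ := etcPolicy_explore τ (designedQueries d π ε) ihat
    refine B.law_measureReal_le_of_nonadaptive _ ρ hρ _ fun q hqρ S hS => ?_
    have hx' := fun a v => IsGOptimal.abs_inner_le B hπ hε q (hq q hqρ) a v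
    refine (B.sum_feedbackMass_not_accurateMLE_le hd hκ hμ hM hε hl q hx'
      (IsGOptimal.injective_queryMap B hπ _ hx') hsmall S fun r hr hacc => ?_).trans hx
    exact hS r hr (B.iSup_borda_sub_le hμ hL (hacc.2 _ (hθ _ hacc.1)) (hi _))

/-- An expectation bound from a tail bound. -/
theorem integral_regret_le (A : Policy K) (T : ℕ) {R x : ℝ} (hR : 0 ≤ R)
    (h : (B.law A T).toMeasure.real {h | R < B.regret h} ≤ x) :
    ∫ h, B.regret h ∂(B.law A T).toMeasure ≤ R + 2 * T * x := by
  set S := {h : History K T | R < B.regret h}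
  have hS : MeasurableSet S := (Set.toFinite _).measurableSet
  calc ∫ h, B.regret h ∂(B.law A T).toMeasure
      ≤ ∫ h, (R + S.indicator (fun _ => 2 * (T : ℝ)) h) ∂(B.law A T).toMeasure := by
        refine MeasureTheory.integral_mono .of_finite .of_finite fun h => ?_
        by_cases hh : h ∈ S
        · simp only [Set.indicator_of_mem hh]
          linarith [B.regret_le_two_mul h]
        · simp only [Set.indicator_of_notMem hh, add_zero]
          exact not_lt.1 hh
    _ = R + (B.law A T).toMeasure.real S * (2 * T) := by
        rw [MeasureTheory.integral_add .of_finite .of_finite,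
          MeasureTheory.integral_indicator_const _ hS]
        simp
    _ ≤ R + 2 * T * x := by nlinarith [T.cast_nonneg (α := ℝ)]

end GLMBandit

end ExploreThenCommit

/-! ### Choice of the parameters -/

section Parameters

theorem pow_rpow_eq_pow {x : ℝ} (hx : 0 ≤ x) {n m : ℕ} {p : ℝ} (h : n * p = m) :
    (x ^ n) ^ p = x ^ m := by
  rw [← Real.rpow_natCast, ← Real.rpow_mul hx, h, Real.rpow_natCast]

theorem exists_pow_eq {a : ℝ} (ha : 0 ≤ a) {n : ℕ} (hn : n ≠ 0) : ∃ x, 0 ≤ x ∧ x ^ n = a :=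
  ⟨a ^ (n⁻¹ : ℝ), Real.rpow_nonneg ha _, Real.rpow_inv_natCast_pow ha hn⟩

theorem mul_succ_div_two_le_sq (n : ℕ) : n * (n + 1) / 2 ≤ n ^ 2 := by
  have := Nat.le_self_pow two_ne_zero n
  refine Nat.div_le_of_le_mul ?_
  linarith [show n * (n + 1) = n ^ 2 + n by ring]

theorem le_of_pow_le {a b : ℝ} (hb : 0 ≤ b) {n : ℕ} (hn : n ≠ 0) (h : a ^ n ≤ b ^ n) : a ≤ b :=
  le_of_not_gt fun hlt => absurd (pow_lt_pow_left₀ hlt hb hn) (not_lt.2 h)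

/-- The lower bound on the horizon, in terms of roots of the parameters: `x = d^{1/6}`,
`s = T^{1/3}`, `e = lam0^{1/2}` and `y = log(K²/δ)^{1/3}`. -/
theorem horizon_bounds {x s e k y g : ℝ} (hx : 1 ≤ x) (hs : 0 ≤ s) (he : 0 < e) (hk : 0 < k)
    (hg : 0 ≤ g) (hex : e ^ 2 * x ^ 6 ≤ 1)
    (hT : g ^ 3 / (k ^ 6 * e ^ 3) * max (x ^ 15) (y ^ 3 / x ^ 3) ≤ s ^ 3) :
    g * x ^ 8 ≤ s * k ^ 2 ∧ g * y * x ^ 2 ≤ s * k ^ 2 := by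
  have hx0 : 0 < x := by linarith
  have hex1 : e * x ^ 3 ≤ 1 := by
    refine le_of_pow_le zero_le_one two_ne_zero ?_
    calc (e * x ^ 3) ^ 2 = e ^ 2 * x ^ 6 := by ring
      _ ≤ 1 ^ 2 := by simpa using hex
  have hsk : 0 ≤ s * k ^ 2 := by positivity
  have hc : 0 ≤ g ^ 3 / (k ^ 6 * e ^ 3) := by positivity
  have h1 := (mul_le_mul_of_nonneg_left (le_max_left (x ^ 15) (y ^ 3 / x ^ 3)) hc).trans hT
  have h2 := (mul_le_mul_of_nonneg_left (le_max_right (x ^ 15) (y ^ 3 / x ^ 3)) hc).trans hT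
  rw [div_mul_eq_mul_div, div_le_iff₀ (by positivity)] at h1
  rw [div_mul_div_comm, div_le_iff₀ (by positivity)] at h2
  -- Cube roots of the two halves of the horizon condition; the spare factor `e` is then traded for
  -- `x ^ 3` by `hex1`.
  have h3 : g * x ^ 5 ≤ s * k ^ 2 * e :=
    le_of_pow_le (by positivity) three_ne_zero (by ring_nf at h1 ⊢; exact h1)
  have h4 : g * y ≤ s * k ^ 2 * e * x :=
    le_of_pow_le (by positivity) three_ne_zero (by ring_nf at h2 ⊢; exact h2)
  constructor
  · calc g * x ^ 8 = (g * x ^ 5) * x ^ 3 := by ring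
      _ ≤ (s * k ^ 2 * e) * x ^ 3 := by gcongr
      _ = s * k ^ 2 * (e * x ^ 3) := by ring
      _ ≤ s * k ^ 2 := mul_le_of_le_one_right hsk hex1
  · calc g * y * x ^ 2 ≤ (s * k ^ 2 * e * x) * x ^ 2 := by gcongr
      _ = s * k ^ 2 * (e * x ^ 3) := by ring
      _ ≤ s * k ^ 2 := mul_le_of_le_one_right hsk hex1

/-- The error tolerance is small enough for the linearization of the link function. -/
theorem tolerance_small {x s k y b g M : ℝ} (hx : 1 ≤ x) (hs : 0 < s) (hb : 1 ≤ b)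
    (hby : b ^ 2 ≤ 3 * y) (hM : 0 ≤ M) (hg : 128 * M ≤ g)
    (h1 : g * x ^ 8 ≤ s * k ^ 2) (h2 : g * y * x ^ 2 ≤ s * k ^ 2) :
    8 * M * (4 * √((x ^ 6) ^ 2 + b ^ 6)) * (x ^ 2 * s⁻¹ * b⁻¹) ≤ k ^ 2 := by
  have hx0 : 0 < x := by linarith
  have hb0 : 0 < b := by linarith
  -- This splits the tolerance condition into a dimension part, handled by `h1`, and a logarithmic
  -- part, handled by `h2`.
  have hsqrt : √((x ^ 6) ^ 2 + b ^ 6) ≤ x ^ 6 + b ^ 3 := by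
    rw [Real.sqrt_le_left (by positivity)]
    have : 0 ≤ x ^ 6 * b ^ 3 := by positivity
    nlinarith
  have h3 : 128 * M * x ^ 8 ≤ s * k ^ 2 * b :=
    calc 128 * M * x ^ 8 ≤ g * x ^ 8 := by gcongr
      _ ≤ s * k ^ 2 := h1
      _ ≤ s * k ^ 2 * b := le_mul_of_one_le_right (by positivity) hb
  have h4 : 128 * M * (b ^ 3 * x ^ 2) ≤ 3 * (s * k ^ 2 * b) := by
    have hy : 0 ≤ y := by nlinarith
    calc 128 * M * (b ^ 3 * x ^ 2) = 128 * M * (b ^ 2 * (b * x ^ 2)) := by ring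
      _ ≤ 128 * M * (3 * y * (b * x ^ 2)) := by gcongr
      _ ≤ g * (3 * y * (b * x ^ 2)) := by gcongr
      _ = 3 * (g * y * x ^ 2) * b := by ring
      _ ≤ 3 * (s * k ^ 2) * b := by gcongr
      _ = 3 * (s * k ^ 2 * b) := by ring
  calc 8 * M * (4 * √((x ^ 6) ^ 2 + b ^ 6)) * (x ^ 2 * s⁻¹ * b⁻¹)
      ≤ 8 * M * (4 * (x ^ 6 + b ^ 3)) * (x ^ 2 * s⁻¹ * b⁻¹) := by gcongr
    _ = (128 * M * x ^ 8 + 128 * M * (b ^ 3 * x ^ 2)) / (4 * (s * b)) := by field_simp; ring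
    _ ≤ k ^ 2 := by
      rw [div_le_iff₀ (by positivity)]
      nlinarith

/-- The sum of exploration and exploitation costs. -/
theorem regret_budget {x s k b z g L Lb τ : ℝ} (hx : 1 ≤ x) (hs : 0 < s) (hk : 0 < k)
    (hb : 1 ≤ b) (hz : 1 ≤ z) (hbz : b ^ 2 ≤ 3 * z) (hL0 : 0 ≤ L) (hL : L ≤ Lb) (hkL : k ≤ Lb)
    (hg : Lb ^ 2 ≤ g) (h1 : g * x ^ 8 ≤ s * k ^ 2) (hτ : τ ≤ x ^ 2 * z * s ^ 2 + 1) :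
    2 * (τ + (x ^ 6 / (x ^ 2 * s⁻¹ * b⁻¹) ^ 2 + (x ^ 6) ^ 2)) +
        s ^ 3 * (2 * (2 * (L * (2 * (x ^ 2 * s⁻¹ * b⁻¹ / k * b ^ 3))))) ≤
      36 * Lb * (k⁻¹ * (x ^ 2 * z) * s ^ 2) := by
  have hx0 : 0 < x := by linarith
  have hb0 : 0 < b := by linarith
  -- That is `d^{4/3} ≤ T^{1/3}`, which makes the rounding cost `d²` negligible.
  have hsx : x ^ 8 ≤ s := by
    have h2 : x ^ 8 * k ^ 2 ≤ s * k ^ 2 := by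
      refine le_trans ?_ h1
      rw [mul_comm]
      gcongr
      exact (pow_le_pow_left₀ hk.le hkL 2).trans hg
    exact le_of_mul_le_mul_right h2 (by positivity)
  set D := x ^ 2 * z * s ^ 2 with hD
  have hs1 : 1 ≤ s := (one_le_pow₀ hx).trans hsx
  have hD1 : 1 ≤ D := one_le_mul_of_one_le_of_one_le
    (one_le_mul_of_one_le_of_one_le (one_le_pow₀ hx) hz) (one_le_pow₀ hs1)
  have h3 : x ^ 6 / (x ^ 2 * s⁻¹ * b⁻¹) ^ 2 = x ^ 2 * b ^ 2 * s ^ 2 := by field_simp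
  have h4 : x ^ 2 * b ^ 2 * s ^ 2 ≤ 3 * D := by
    calc x ^ 2 * b ^ 2 * s ^ 2 ≤ x ^ 2 * (3 * z) * s ^ 2 := by gcongr
      _ = 3 * D := by rw [hD]; ring
  have h5 : (x ^ 6) ^ 2 ≤ D := by
    calc (x ^ 6) ^ 2 = x ^ 12 := by ring
      _ ≤ x ^ 18 := pow_le_pow_right₀ hx (by norm_num)
      _ = x ^ 2 * 1 * (x ^ 8) ^ 2 := by ring
      _ ≤ D := by rw [hD]; gcongr
  have h6 : s ^ 3 * (2 * (2 * (L * (2 * (x ^ 2 * s⁻¹ * b⁻¹ / k * b ^ 3))))) =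
      8 * L * k⁻¹ * (x ^ 2 * b ^ 2 * s ^ 2) := by field_simp; ring
  have h7 : 8 * L * k⁻¹ * (x ^ 2 * b ^ 2 * s ^ 2) ≤ 24 * (Lb * k⁻¹ * D) := by
    have hLb : 0 ≤ Lb := hL0.trans hL
    calc 8 * L * k⁻¹ * (x ^ 2 * b ^ 2 * s ^ 2) ≤ 8 * Lb * k⁻¹ * (3 * D) := by gcongr
      _ = _ := by ring
  have h8 : D ≤ Lb * k⁻¹ * D := by
    refine le_mul_of_one_le_left (by linarith) ?_
    rw [← div_eq_mul_inv, one_le_div hk]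
    exact hkL
  rw [h3, h6]
  -- Exploration costs at most `2((D + 1) + 3D + D) ≤ 12D`, exploitation `24 Lb k⁻¹ D`.
  calc _ ≤ 36 * (Lb * k⁻¹ * D) := by linarith
    _ = _ := by rw [hD]; ring

/-- Here `K / δ ≥ 4 > e`, and `3K²/δ ≤ (K/δ)³` because `3δ² ≤ K`. -/
theorem log_bounds {K δ : ℝ} (hK : 2 ≤ K) (hδ : 0 < δ) (hδ' : δ < 1 / 2) :
    1 ≤ Real.log (K / δ) ∧ Real.log (K / δ) ≤ Real.log (K ^ 2 / δ) ∧
      1 ≤ Real.log (3 * K ^ 2 / δ) ∧ Real.log (3 * K ^ 2 / δ) ≤ 3 * Real.log (K / δ) := by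
  have h4 : 4 ≤ K / δ := by rw [le_div_iff₀ hδ]; linarith
  have h0 : 0 < K / δ := by linarith
  have h1 : 1 ≤ Real.log (K / δ) := by
    rw [Real.le_log_iff_exp_le h0]
    linarith [Real.exp_one_lt_d9]
  have h2 : Real.log (K / δ) ≤ Real.log (K ^ 2 / δ) := Real.log_le_log h0 (by gcongr; nlinarith)
  refine ⟨h1, h2, (h1.trans h2).trans (Real.log_le_log (by positivity) ?_), ?_⟩
  · gcongr; nlinarith
  · rw [show (3 : ℝ) = ((3 : ℕ) : ℝ) by norm_num, ← Real.log_pow]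
    refine Real.log_le_log (by positivity) ?_
    rw [div_pow, div_le_div_iff₀ hδ (by positivity)]
    push_cast
    have : 3 * δ ^ 2 ≤ K := by nlinarith
    have := mul_le_mul_of_nonneg_left this (show 0 ≤ K ^ 2 * δ by positivity)
    nlinarith

namespace GLMBandit

variable {K d : ℕ} [NeZero K] (B : GLMBandit K d)

/-- The constant of the lower bound on the horizon, as a function of the bounds on the first two
derivatives of the link function. -/
def horizonConst (L M : ℝ) : ℝ := 128 * |M| + 2 * (|L| + 1) ^ 2

theorem horizonConst_pos (L M : ℝ) : 0 < horizonConst L M := by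
  unfold horizonConst; positivity

theorem kappa_le {L M : ℝ} (hμ : B.SmoothLink L M) : B.kappa ≤ L :=
  (B.kappa_le_deriv 0 0).trans ((le_abs_self _).trans (hμ.2.2.1 _))

theorem horizon_root_bounds {L M lam0 ℓ x s y : ℝ} {T : ℕ} (hd : 1 ≤ d)
    (h0 : 0 < lam0) (hlam : B.MinEigenvalueGE lam0) (hκ : 0 < B.kappa)
    (hT : horizonConst L M ^ 3 / (B.kappa ^ 6 * lam0 ^ (3 / 2 : ℝ)) *
      max ((d : ℝ) ^ (5 / 2 : ℝ)) (ℓ / √d) ≤ T)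
    (hx : 0 ≤ x) (hxd : x ^ 6 = d) (hs : 0 ≤ s) (hsT : s ^ 3 = T) (hyl : y ^ 3 = ℓ) :
    horizonConst L M * x ^ 8 ≤ s * B.kappa ^ 2 ∧
      horizonConst L M * y * x ^ 2 ≤ s * B.kappa ^ 2 := by
  have hd1 : (1 : ℝ) ≤ d := by exact_mod_cast hd
  obtain ⟨e, he, hel⟩ := exists_pow_eq h0.le two_ne_zero
  have he0 : 0 < e := he.lt_of_ne (by rintro rfl; simp at hel; exact h0.ne hel)
  have hx1 : 1 ≤ x := le_of_pow_le hx (n := 6) (by norm_num) (by simpa [hxd] using hd1)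
  have htr := (MinEigenvalueGE.mul_le_trace B hlam).trans B.trace_uniformMatrix_le
  rw [← hxd, ← hyl, ← hel, ← hsT, pow_rpow_eq_pow hx (m := 15) (by norm_num),
    pow_rpow_eq_pow he (m := 3) (by norm_num), Real.sqrt_eq_rpow,
    pow_rpow_eq_pow hx (m := 3) (by norm_num)] at hT
  refine horizon_bounds hx1 hs he0 hκ (horizonConst_pos L M).le ?_ hT
  rw [hel, hxd, mul_comm]
  exact htr

/-- The horizon is at least eight. -/
theorem eight_le_horizon {L M lam0 ℓ : ℝ} {T : ℕ} (hd : 1 ≤ d)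
    (h0 : 0 < lam0) (hlam : B.MinEigenvalueGE lam0) (hκ : 0 < B.kappa) (hμ : B.SmoothLink L M)
    (hℓ : 0 ≤ ℓ)
    (hT : horizonConst L M ^ 3 / (B.kappa ^ 6 * lam0 ^ (3 / 2 : ℝ)) *
      max ((d : ℝ) ^ (5 / 2 : ℝ)) (ℓ / √d) ≤ T) : (8 : ℝ) ≤ T := by
  have hd1 : (1 : ℝ) ≤ d := by exact_mod_cast hd
  obtain ⟨x, hx, hxd⟩ := exists_pow_eq d.cast_nonneg (n := 6) (a := (d : ℝ)) (by norm_num)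
  obtain ⟨s, hs, hsT⟩ := exists_pow_eq T.cast_nonneg (n := 3) (a := (T : ℝ)) (by norm_num)
  obtain ⟨y, -, hyl⟩ := exists_pow_eq hℓ three_ne_zero
  have hx1 : 1 ≤ x := le_of_pow_le hx (n := 6) (by norm_num) (by simpa [hxd] using hd1)
  have h1 := (B.horizon_root_bounds hd h0 hlam hκ hT hx hxd hs hsT hyl).1
  have hkL : B.kappa ≤ |L| + 1 := (B.kappa_le hμ).trans ((le_abs_self L).trans (by linarith))
  -- The summand `2(|L| + 1)²` of the constant serves to give `T^{1/3} ≥ 2`.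
  have h2 : 2 * B.kappa ^ 2 ≤ horizonConst L M := by
    have := pow_le_pow_left₀ hκ.le hkL 2
    have := abs_nonneg M
    unfold horizonConst
    linarith
  have h3 : horizonConst L M ≤ horizonConst L M * x ^ 8 :=
    le_mul_of_one_le_right (horizonConst_pos L M).le (one_le_pow₀ hx1)
  have h4 : 2 ≤ s := le_of_mul_le_mul_right (h2.trans (h3.trans h1)) (by positivity)
  rw [← hsT]
  calc (8 : ℝ) = 2 ^ 3 := by norm_num
    _ ≤ s ^ 3 := by gcongr

set_option maxHeartbeats 1000000 in
/-- The tail bound for the regret of BETC-GLM with the prescribed parameters. -/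
theorem law_regret_gt_le_of_params {L M lam0 δ : ℝ} {T : ℕ} {A : Policy K} (hd : 1 ≤ d)
    (h0 : 0 < lam0) (hlam : B.MinEigenvalueGE lam0) (hκ : 0 < B.kappa) (hμ : B.SmoothLink L M)
    (hδ : 0 < δ) (hδ' : δ < 1 / 2)
    (hT : horizonConst L M ^ 3 / (B.kappa ^ 6 * lam0 ^ (3 / 2 : ℝ)) *
      max ((d : ℝ) ^ (5 / 2 : ℝ)) (Real.log ((K : ℝ) ^ 2 / δ) / √d) ≤ T)
    (hA : IsBETCGLM B (tauParam K d T δ) (epsParam K d T δ) A) :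
    1 ≤ ((d : ℝ) * Real.log (K / δ)) ^ (1 / 3 : ℝ) * (T : ℝ) ^ (2 / 3 : ℝ) ∧
    (B.law A T).toMeasure.real {h | 36 * (|L| + 1) *
      (B.kappa⁻¹ * ((d : ℝ) * Real.log (K / δ)) ^ (1 / 3 : ℝ) * (T : ℝ) ^ (2 / 3 : ℝ)) <
        B.regret h} ≤ 2 * δ := by
  have hd1 : (1 : ℝ) ≤ d := by exact_mod_cast hd
  have hK : (2 : ℝ) ≤ K := by exact_mod_cast B.two_le_of_minEigenvalueGE hd h0 hlam
  obtain ⟨hl1, hl2, hl3, hl4⟩ := log_bounds hK hδ hδ'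
  have h8 := B.eight_le_horizon hd h0 hlam hκ hμ (by linarith) hT
  -- Roots of all parameters turn the real powers into polynomial expressions.
  obtain ⟨x, hx, hxd⟩ := exists_pow_eq d.cast_nonneg (n := 6) (a := (d : ℝ)) (by norm_num)
  obtain ⟨s, hs, hsT⟩ := exists_pow_eq T.cast_nonneg (n := 3) (a := (T : ℝ)) (by norm_num)
  obtain ⟨y, hy, hyl⟩ := exists_pow_eq (n := 3) (a := Real.log ((K : ℝ) ^ 2 / δ))
    (by linarith) (by norm_num)
  obtain ⟨z, hz, hzl⟩ := exists_pow_eq (n := 3) (a := Real.log ((K : ℝ) / δ))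
    (by linarith) (by norm_num)
  obtain ⟨b, hb, hbl⟩ := exists_pow_eq (n := 6) (a := Real.log (3 * (K : ℝ) ^ 2 / δ))
    (by linarith) (by norm_num)
  have hx1 : 1 ≤ x := le_of_pow_le hx (n := 6) (by norm_num) (by simpa [hxd] using hd1)
  have hz1 : 1 ≤ z := le_of_pow_le hz (n := 3) (by norm_num) (by simpa [hzl] using hl1)
  have hb1 : 1 ≤ b := le_of_pow_le hb (n := 6) (by norm_num) (by simpa [hbl] using hl3)
  have hs1 : 1 ≤ s := le_of_pow_le hs (n := 3) (by norm_num) (by rw [hsT]; linarith)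
  have hby : b ^ 2 ≤ 3 * y := by
    refine le_of_pow_le (by positivity) three_ne_zero ?_
    rw [← pow_mul, mul_pow, hyl, hbl]
    linarith
  have hbz : b ^ 2 ≤ 3 * z := by
    refine le_of_pow_le (by positivity) three_ne_zero ?_
    rw [← pow_mul, mul_pow, hzl, hbl]
    linarith
  obtain ⟨hh1, hh2⟩ := B.horizon_root_bounds hd h0 hlam hκ hT hx hxd hs hsT hyl
  have hT2 : (T : ℝ) ^ (2 / 3 : ℝ) = s ^ 2 := by
    rw [← hsT, pow_rpow_eq_pow hs (m := 2) (by norm_num)]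
  have hT1 : (T : ℝ) ^ (-(1 / 3) : ℝ) = s⁻¹ := by
    rw [Real.rpow_neg T.cast_nonneg, ← hsT, pow_rpow_eq_pow hs (m := 1) (by norm_num), pow_one]
  have hdl : ((d : ℝ) * Real.log (K / δ)) ^ (1 / 3 : ℝ) = x ^ 2 * z := by
    rw [← hzl, ← hxd, show x ^ 6 * z ^ 3 = (x ^ 2 * z) ^ 3 by ring,
      pow_rpow_eq_pow (by positivity) (m := 1) (by norm_num), pow_one]
  have hε : epsParam K d T δ = x ^ 2 * s⁻¹ * b⁻¹ := by
    rw [epsParam, hT1, Real.rpow_neg (by linarith), ← hbl,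
      pow_rpow_eq_pow hb (m := 1) (by norm_num), pow_one, ← hxd,
      pow_rpow_eq_pow hx (m := 2) (by norm_num)]
  have hτ : (tauParam K d T δ : ℝ) ≤ x ^ 2 * z * s ^ 2 + 1 := by
    rw [tauParam, hdl, hT2]
    exact (Nat.ceil_lt_add_one (by positivity)).le
  have hsq : √(b ^ 6) = b ^ 3 := by
    rw [show b ^ 6 = (b ^ 3) ^ 2 by ring, Real.sqrt_sq (by positivity)]
  have hL : L ≤ |L| + 1 := (le_abs_self L).trans (by linarith)
  have hkL := B.kappa_le hμ
  have hM : 0 ≤ M := (abs_nonneg _).trans (hμ.2.2.2 0)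
  have hg1 : 128 * M ≤ horizonConst L M := by
    unfold horizonConst; rw [abs_of_nonneg hM]; nlinarith [sq_nonneg (|L| + 1)]
  have hg2 : (|L| + 1) ^ 2 ≤ horizonConst L M := by
    unfold horizonConst; nlinarith [sq_nonneg (|L| + 1), abs_nonneg M]
  constructor
  · rw [hdl, hT2]
    exact one_le_mul_of_one_le_of_one_le
      (one_le_mul_of_one_le_of_one_le (one_le_pow₀ hx1) hz1) (one_le_pow₀ hs1)
  rw [hε] at hA
  refine B.law_regret_gt_le (l := Real.log (3 * (K : ℝ) ^ 2 / δ)) (N := d ^ 2) hd hκ hμ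
    (hκ.le.trans hkL) hM ?_ (by linarith) hA ?_ ?_ ?_ ?_
  · have : 0 < s := by linarith
    have : 0 < b := by linarith
    positivity
  · exact mul_succ_div_two_le_sq d
  · rw [← hbl, ← hxd]
    exact tolerance_small hx1 (by linarith) hb1 hby hM hg1 hh1 hh2
  -- With `exp(-l) = δ / (3K²)` the union bound totals `(2K² + 1) δ / (3K²) ≤ 2δ`.
  · rw [Real.exp_neg, Real.exp_log (by positivity), inv_div, mul_div_assoc',
      div_le_iff₀ (by positivity)]
    have hK1 : 1 ≤ (K : ℝ) ^ 2 := one_le_pow₀ (by linarith)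
    calc (2 * (K : ℝ) ^ 2 + 1) * δ ≤ (6 * (K : ℝ) ^ 2) * δ := by gcongr; linarith
      _ = 2 * δ * (3 * (K : ℝ) ^ 2) := by ring
  · rw [← hbl, hsq, hdl, hT2, ← hsT]
    push_cast
    rw [← hxd]
    exact regret_budget hx1 (by linarith) hκ hb1 hz1 hbz (hκ.le.trans hkL) hL (hkL.trans hL) hg2
      hh1 hτ

end GLMBandit

/-- Since `log K ≥ 1/2`, the sum of the logarithms is at most `8 log K (1 + log T)`; the factor `2`
is the cube root of `8`. -/
theorem rpow_mul_log_mul_le {d K T : ℝ} (hd : 0 ≤ d) (hK : 2 ≤ K) (hT : 1 ≤ T) :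
    (d * Real.log (K * T)) ^ (1 / 3 : ℝ) ≤
      2 * ((d * Real.log K) ^ (1 / 3 : ℝ) * (1 + Real.log T) ^ (1 / 3 : ℝ)) := by
  have hlT : 0 ≤ Real.log T := Real.log_nonneg hT
  have hlK : 1 / 2 ≤ Real.log K := by
    have := Real.log_le_log two_pos hK
    linarith [Real.log_two_gt_d9]
  have h2 : (2 : ℝ) = (2 ^ 3) ^ (1 / 3 : ℝ) := by
    rw [pow_rpow_eq_pow (by norm_num) (m := 1) (by norm_num), pow_one]
  have hdK : 0 ≤ d * Real.log K := mul_nonneg hd (by linarith)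
  rw [← Real.mul_rpow hdK (by linarith)]
  conv_rhs => rw [h2]
  rw [← Real.mul_rpow (by norm_num) (mul_nonneg hdK (by linarith)),
    Real.log_mul (by linarith) (by linarith)]
  have hlog : Real.log K + Real.log T ≤ 8 * (Real.log K * (1 + Real.log T)) := by
    nlinarith
  refine Real.rpow_le_rpow (mul_nonneg hd (by linarith)) ?_ (by norm_num)
  have := mul_le_mul_of_nonneg_left hlog hd
  linarith

end Parameters

end BordaDueling

end

/-- The tail bound has constant `36(|L| + 1)`. The failure event adds at most `2T · 2/T = 4` to the
expectation, which makes `40(|L| + 1)`, and separating `log K` from `log T` doubles it to `80(|L| +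
1)`. -/
theorem theoremA1 (L M : ℝ) :
    ∃ C₃ C : ℝ, 0 < C₃ ∧ 0 < C ∧
      ∀ (K d : ℕ) [NeZero K] (B : BordaDueling.GLMBandit K d) (lam0 : ℝ),
        1 ≤ d → 0 < lam0 → B.MinEigenvalueGE lam0 → 0 < B.kappa → B.SmoothLink L M →
        ∀ T : ℕ,
          (∀ δ : ℝ, 0 < δ →
            C₃ / (B.kappa ^ 6 * lam0 ^ (3 / 2 : ℝ)) *
                max ((d : ℝ) ^ (5 / 2 : ℝ)) (Real.log ((K : ℝ) ^ 2 / δ) / Real.sqrt d) ≤ T →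
            ∀ A : BordaDueling.Policy K,
              BordaDueling.IsBETCGLM B (BordaDueling.tauParam K d T δ)
                (BordaDueling.epsParam K d T δ) A →
              1 - 2 * δ ≤ (B.law A T).toMeasure.real
                {h | B.regret h ≤
                  C * (B.kappa⁻¹ * ((d : ℝ) * Real.log (K / δ)) ^ (1 / 3 : ℝ) *
                    (T : ℝ) ^ (2 / 3 : ℝ))}) ∧
          (C₃ / (B.kappa ^ 6 * lam0 ^ (3 / 2 : ℝ)) *
                max ((d : ℝ) ^ (5 / 2 : ℝ))
                  (Real.log ((K : ℝ) ^ 2 * T) / Real.sqrt d) ≤ T →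
            ∀ A : BordaDueling.Policy K,
              BordaDueling.IsBETCGLM B (BordaDueling.tauParam K d T ((T : ℝ)⁻¹))
                (BordaDueling.epsParam K d T ((T : ℝ)⁻¹)) A →
              (∫ h, B.regret h ∂(B.law A T).toMeasure) ≤
                  C * (B.kappa⁻¹ * ((d : ℝ) * Real.log (K * T)) ^ (1 / 3 : ℝ) *
                    (T : ℝ) ^ (2 / 3 : ℝ)) ∧
              (∫ h, B.regret h ∂(B.law A T).toMeasure) ≤
                  C * (B.kappa⁻¹ * ((d : ℝ) * Real.log K) ^ (1 / 3 : ℝ) *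
                    (T : ℝ) ^ (2 / 3 : ℝ)) * (1 + Real.log T) ^ (1 / 3 : ℝ)) := by
  have hL1 : 0 < |L| + 1 := by positivity
  refine ⟨BordaDueling.GLMBandit.horizonConst L M ^ 3, 80 * (|L| + 1),
    pow_pos (BordaDueling.GLMBandit.horizonConst_pos L M) 3, by positivity, ?_⟩
  intro K d _ B lam0 hd h0 hlam hκ hμ T
  have hK : (2 : ℝ) ≤ K := by exact_mod_cast B.two_le_of_minEigenvalueGE hd h0 hlam
  constructor
  · intro δ hδ hT A hA
    -- For `δ ≥ 1/2` the claimed probability is at most zero.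
    rcases le_or_gt (1 / 2) δ with hδ' | hδ'
    · exact le_trans (by linarith) MeasureTheory.measureReal_nonneg
    obtain ⟨hD, htail⟩ := B.law_regret_gt_le_of_params hd h0 hlam hκ hμ hδ hδ' hT hA
    have hcompl := MeasureTheory.probReal_compl_eq_one_sub (μ := (B.law A T).toMeasure)
      (s := {h | 36 * (|L| + 1) * (B.kappa⁻¹ * ((d : ℝ) * Real.log (K / δ)) ^ (1 / 3 : ℝ) *
        (T : ℝ) ^ (2 / 3 : ℝ)) < B.regret h}) (Set.toFinite _).measurableSet
    refine le_trans (by rw [hcompl]; linarith) (MeasureTheory.measureReal_mono ?_)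
    intro h hh
    rw [Set.mem_compl_iff, Set.mem_ofPred_eq, not_lt] at hh
    refine hh.trans ?_
    have : 0 ≤ B.kappa⁻¹ * ((d : ℝ) * Real.log (K / δ)) ^ (1 / 3 : ℝ) *
        (T : ℝ) ^ (2 / 3 : ℝ) := by
      rw [mul_assoc]
      exact mul_nonneg (inv_nonneg.2 hκ.le) (by linarith)
    gcongr
    norm_num
  · intro hT A hA
    have hdiv : (K : ℝ) ^ 2 * T = (K : ℝ) ^ 2 / (T : ℝ)⁻¹ := by rw [div_inv_eq_mul]
    rw [hdiv] at hT
    -- At this point `T = 0` is not yet excluded; `Real.log 0 = 0` covers it.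
    have hlog : 0 ≤ Real.log ((K : ℝ) ^ 2 / (T : ℝ)⁻¹) := by
      rw [← hdiv, show (K : ℝ) ^ 2 * T = ((K ^ 2 * T : ℕ) : ℝ) by push_cast; rfl]
      exact Real.log_natCast_nonneg _
    have h8 := B.eight_le_horizon hd h0 hlam hκ hμ hlog hT
    have hT0 : (0 : ℝ) < T := by linarith
    have hδ' : (T : ℝ)⁻¹ < 1 / 2 := by
      rw [inv_lt_comm₀ hT0 (by norm_num)]; linarith
    obtain ⟨hD, htail⟩ := B.law_regret_gt_le_of_params hd h0 hlam hκ hμ (inv_pos.2 hT0) hδ' hT hA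
    rw [div_inv_eq_mul] at hD htail
    set D := ((d : ℝ) * Real.log (K * T)) ^ (1 / 3 : ℝ) * (T : ℝ) ^ (2 / 3 : ℝ) with hDdef
    have hκD : B.kappa⁻¹ * ((d : ℝ) * Real.log (K * T)) ^ (1 / 3 : ℝ) * (T : ℝ) ^ (2 / 3 : ℝ) =
        B.kappa⁻¹ * D := by rw [hDdef, mul_assoc]
    rw [hκD] at htail ⊢
    have hκi : 0 < B.kappa⁻¹ := inv_pos.2 hκ
    have hint := B.integral_regret_le A T (by positivity) htail
    have h1 : 1 ≤ (|L| + 1) * (B.kappa⁻¹ * D) := by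
      rw [← mul_assoc]
      refine one_le_mul_of_one_le_of_one_le ?_ hD
      rw [← div_eq_mul_inv, one_le_div hκ]
      exact (B.kappa_le hμ).trans ((le_abs_self L).trans (by linarith))
    have h4 : 2 * (T : ℝ) * (2 * (T : ℝ)⁻¹) = 4 := by field_simp; norm_num
    have hE : ∫ h, B.regret h ∂(B.law A T).toMeasure ≤ 40 * (|L| + 1) * (B.kappa⁻¹ * D) := by
      linarith
    refine ⟨by linarith, hE.trans ?_⟩
    have hroot := BordaDueling.rpow_mul_log_mul_le d.cast_nonneg hK (show (1 : ℝ) ≤ T by linarith)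
    calc 40 * (|L| + 1) * (B.kappa⁻¹ * D)
        ≤ 40 * (|L| + 1) * (B.kappa⁻¹ * (2 * (((d : ℝ) * Real.log K) ^ (1 / 3 : ℝ) *
          (1 + Real.log T) ^ (1 / 3 : ℝ)) * (T : ℝ) ^ (2 / 3 : ℝ))) := by
          rw [hDdef]
          gcongr
      _ = _ := by ring
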